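/- **Definitions.** For a formal series $\sum_{v\ge 0} a_v (z-\zeta)^v$ with complex coefficients (put $a_i=0$ for $i<0$) and $p,q\in\mathbb N=\{0,1,2,\dots\}$, a $[p/q]$ Padé approximant is a rational function $$\frac{\sum_{v=0}^p n_v (z-\zeta)^v}{\sum_{v=0}^q d_v (z-\zeta)^v},\qquad d_0=1,$$ whose Taylor series $\sum_v b_v(z-\zeta)^v$ at $\zeta$ satisfies $b_v=a_v$ for $0\le v\le p+q$. If $f$ is holomorphic near $\zeta$ with Taylor coefficients $a_v=f^{(v)}(\zeta)/v!$, write $f\in\mathcal D_{p,q}(\zeta)$ if the Hankel determinant $\det\big(a_{p-q+1+i+j}\big)_{0\le i,j\le q-1}$ is nonzero (an empty determinant, $q=0$, being $1$). In that case there is exactly one such pair of numerator and denominator polynomials, and $[p/q]_{f,\zeta}$ denotes the resulting rational function; $|[p/q]_{f,\zeta}(z)-f(z)|$ is taken to be $+\infty$ at its poles. For an open set $\Omega\subseteq\mathbb C$, $H(\Omega)$ is the space of holomorphic functions on $\Omega$ with the topology of uniform convergence on compact subsets of $\Omega$. **Theorem.** Let $\Omega\subseteq\mathbb C$ be an arbitrary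 open set and let $\mathcal F\subseteq\mathbb N\times\mathbb N$ contain a sequence $(\tilde p_n,\tilde q_n)\in\mathcal F$, $n=1,2,\dots$, with $\tilde p_n\to+\infty$ and $\tilde q_n\to+\infty$. Then there exists $f\in H(\Omega)$ with the following property: there is a sequence $(p_n,q_n)_{n\in\mathbb N}$ in $\mathcal F$ such that for every compact set $K\subseteq\Omega$ there is $n(K)\in\mathbb N$ with $f\in\mathcal D_{p_n,q_n}(\zeta)$ for all $n\ge n(K)$ and all $\zeta\in K$, and $$\sup_{\zeta\in K}\ \sup_{z\in K}\big|[p_n/q_n]_{f,\zeta}(z)-f(z)\big|\longrightarrow 0\qquad (n\to\infty).$$ Moreover, the set of all $f\in H(\Omega)$ with this property is a dense $G_\delta$ subset of $H(\Omega)$. -/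

import Mathlib

open Filter Topology
open scoped Polynomial PowerSeries ENNReal

noncomputable section

/-- The coefficients of a formal power series, indexed by `ℤ`, with `a_k = 0` for `k < 0`. -/
def coeffZ (a : ℂ⟦X⟧) (k : ℤ) : ℂ :=
  if 0 ≤ k then PowerSeries.coeff k.toNat a else 0

/-- The `q × q` Hankel matrix with first row `a_{p-q+1}, …, a_p` and last row
`a_p, …, a_{p+q-1}`. -/
def hankelMatrix (a : ℂ⟦X⟧) (p q : ℕ) : Matrix (Fin q) (Fin q) ℂ :=
  Matrix.of fun i j => coeffZ a ((p : ℤ) - (q : ℤ) + 1 + (i : ℤ) + (j : ℤ))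

/-- The fraction `N / D` is a `[p/q]` Padé approximant of the formal series `a`: `N` and `D` are
polynomials (in the local variable `w = z - ζ`) of degree at most `p` and `q`, `D` has constant term
`1`, and the Taylor series of `N / D` agrees with `a` in all degrees `v ≤ p + q`. -/
structure IsPadeApproximant (a : ℂ⟦X⟧) (p q : ℕ) (N D : ℂ[X]) : Prop where
  natDegree_num_le : N.natDegree ≤ p
  natDegree_den_le : D.natDegree ≤ q
  den_coeff_zero : D.coeff 0 = 1
  coeff_eq : ∀ v ≤ p + q,
    PowerSeries.coeff v ((N : ℂ⟦X⟧) * (D : ℂ⟦X⟧)⁻¹) = PowerSeries.coeff v a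

theorem coeff_X_pow_mul_eq_coeffZ (a : ℂ⟦X⟧) (k n : ℕ) :
    PowerSeries.coeff n ((PowerSeries.X : ℂ⟦X⟧) ^ k * a) = coeffZ a ((n : ℤ) - k) := by
  rw [PowerSeries.coeff_X_pow_mul', coeffZ]
  by_cases h : k ≤ n
  · have h1 : ((n : ℤ) - k).toNat = n - k := by omega
    rw [if_pos h, if_pos (by omega), h1]
  · rw [if_neg h, if_neg (by omega)]

/-- The coefficients of `E * a` in the degrees `p + 1, …, p + q`, through the Hankel matrix. -/
theorem coeff_mul_eq_hankel (a : ℂ⟦X⟧) (p q : ℕ) (E : ℂ[X]) (hE : E.natDegree ≤ q) (i : Fin q) :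
    PowerSeries.coeff (p + 1 + i) ((E : ℂ⟦X⟧) * a) =
      E.coeff 0 * PowerSeries.coeff (p + 1 + i) a +
        (hankelMatrix a p q).mulVec (fun l => E.coeff (q - l)) i := by
  have h1 : PowerSeries.coeff (p + 1 + i) ((E : ℂ⟦X⟧) * a) =
      ∑ k ∈ Finset.range (q + 1), E.coeff k * coeffZ a (((p + 1 + i : ℕ) : ℤ) - k) := by
    conv_lhs => rw [E.as_sum_range_C_mul_X_pow' (Nat.lt_succ_of_le hE)]
    rw [← Polynomial.coeToPowerSeries.ringHom_apply, map_sum, Finset.sum_mul, map_sum]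
    refine Finset.sum_congr rfl fun k _ => ?_
    rw [← coeff_X_pow_mul_eq_coeffZ]
    simp [mul_assoc, PowerSeries.coeff_C_mul]
  rw [h1, Finset.sum_range_succ', add_comm]
  refine congrArg₂ (· + ·) ?_ ?_
  · rw [← coeff_X_pow_mul_eq_coeffZ, pow_zero, one_mul]
  · rw [← Finset.sum_range_reflect, Finset.sum_range, Matrix.mulVec, dotProduct]
    refine Finset.sum_congr rfl fun l _ => ?_
    have hl := l.2
    have e1 : q - 1 - (l : ℕ) + 1 = q - l := by omega
    rw [e1, mul_comm, hankelMatrix, Matrix.of_apply]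
    congr 2
    push_cast [Nat.cast_sub hl.le]
    ring

theorem isPadeApproximant_iff (a : ℂ⟦X⟧) (p q : ℕ) (N D : ℂ[X]) :
    IsPadeApproximant a p q N D ↔ N.natDegree ≤ p ∧ D.natDegree ≤ q ∧ D.coeff 0 = 1 ∧
      ∀ v ≤ p + q, N.coeff v = PowerSeries.coeff v ((D : ℂ⟦X⟧) * a) := by
  have key : D.coeff 0 = 1 → ((∀ v ≤ p + q,
      PowerSeries.coeff v ((N : ℂ⟦X⟧) * (D : ℂ⟦X⟧)⁻¹) = PowerSeries.coeff v a) ↔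
      ∀ v ≤ p + q, N.coeff v = PowerSeries.coeff v ((D : ℂ⟦X⟧) * a)) := by
    intro h0
    have hc : PowerSeries.constantCoeff (D : ℂ⟦X⟧) ≠ 0 := by
      rw [← PowerSeries.coeff_zero_eq_constantCoeff_apply, Polynomial.coeff_coe, h0]
      exact one_ne_zero
    have hinv := PowerSeries.mul_inv_cancel _ hc
    have tr : ∀ f g : ℂ⟦X⟧, (∀ v ≤ p + q, PowerSeries.coeff v f = PowerSeries.coeff v g) ↔
        (PowerSeries.X : ℂ⟦X⟧) ^ (p + q + 1) ∣ f - g := by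
      intro f g
      rw [PowerSeries.X_pow_dvd_iff]
      simp only [map_sub, sub_eq_zero, Nat.lt_succ_iff]
    have tr2 := tr (N : ℂ⟦X⟧) ((D : ℂ⟦X⟧) * a)
    simp only [Polynomial.coeff_coe] at tr2
    rw [tr, tr2]
    constructor
    · intro h
      have := h.mul_left (D : ℂ⟦X⟧)
      have e : (D : ℂ⟦X⟧) * ((N : ℂ⟦X⟧) * (D : ℂ⟦X⟧)⁻¹ - a) = (N : ℂ⟦X⟧) - D * a := by
        linear_combination (N : ℂ⟦X⟧) * hinv
      rwa [e] at this
    · intro h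
      have := h.mul_left (D : ℂ⟦X⟧)⁻¹
      have e : (D : ℂ⟦X⟧)⁻¹ * ((N : ℂ⟦X⟧) - D * a) = (N : ℂ⟦X⟧) * (D : ℂ⟦X⟧)⁻¹ - a := by
        linear_combination (-a) * hinv
      rwa [e] at this
  constructor
  · rintro ⟨h1, h2, h3, h4⟩
    exact ⟨h1, h2, h3, (key h3).1 h4⟩
  · rintro ⟨h1, h2, h3, h4⟩
    exact ⟨h1, h2, h3, (key h3).2 h4⟩

/-- If the Hankel determinant does not vanish, the `[p/q]` Padé approximant exists and is
unique. -/
theorem existsUnique_padeApproximant (a : ℂ⟦X⟧) (p q : ℕ) (h : (hankelMatrix a p q).det ≠ 0) :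
    ∃! P : ℂ[X] × ℂ[X], IsPadeApproximant a p q P.1 P.2 := by
  have hu : IsUnit (hankelMatrix a p q).det := isUnit_iff_ne_zero.2 h
  refine existsUnique_of_exists_of_unique ?_ ?_
  · set x : Fin q → ℂ := (hankelMatrix a p q)⁻¹.mulVec
      (fun i : Fin q => - PowerSeries.coeff (p + 1 + i) a) with hx
    have hHx : (hankelMatrix a p q).mulVec x = fun i : Fin q => - PowerSeries.coeff (p + 1 + i) a := by
      rw [hx, Matrix.mulVec_mulVec, Matrix.mul_nonsing_inv _ hu, Matrix.one_mulVec]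
    set D : ℂ[X] := 1 + ∑ l : Fin q, Polynomial.monomial (q - (l : ℕ)) (x l) with hD
    have hdeg : D.natDegree ≤ q := by
      refine (Polynomial.natDegree_add_le _ _).trans (max_le (by simp) ?_)
      refine Polynomial.natDegree_sum_le_of_forall_le _ _ fun l _ => ?_
      exact (Polynomial.natDegree_monomial_le _).trans (Nat.sub_le _ _)
    have h0 : D.coeff 0 = 1 := by
      rw [hD, Polynomial.coeff_add, Polynomial.finsetSum_coeff]
      simp only [Polynomial.coeff_one_zero, Polynomial.coeff_monomial, add_eq_left]
      refine Finset.sum_eq_zero fun l _ => if_neg ?_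
      have := l.2
      omega
    have hco : (fun l : Fin q => D.coeff (q - (l : ℕ))) = x := by
      funext m
      rw [hD, Polynomial.coeff_add, Polynomial.finsetSum_coeff, Polynomial.coeff_one,
        if_neg (by have := m.2; omega), zero_add, Finset.sum_eq_single m]
      · simp
      · intro b _ hb
        rw [Polynomial.coeff_monomial, if_neg]
        have h1 := b.2
        have h2 := m.2
        intro h3
        exact hb (Fin.ext (by omega))
      · simp
    refine ⟨(PowerSeries.trunc (p + 1) ((D : ℂ⟦X⟧) * a), D), ?_⟩
    rw [isPadeApproximant_iff]
    refine ⟨Nat.lt_succ_iff.1 (PowerSeries.natDegree_trunc_lt _ _), hdeg, h0, fun v hv => ?_⟩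
    rw [PowerSeries.coeff_trunc]
    split_ifs with hvp
    · rfl
    · obtain ⟨i, rfl⟩ := Nat.exists_eq_add_of_le (not_lt.1 hvp)
      have := coeff_mul_eq_hankel a p q D hdeg ⟨i, by omega⟩
      rw [hco, hHx, h0] at this
      simpa using this.symm
  · rintro ⟨N, D⟩ ⟨N', D'⟩ h1 h2
    rw [isPadeApproximant_iff] at h1 h2
    obtain ⟨hN, hD, hD0, hc⟩ := h1
    obtain ⟨hN', hD', hD0', hc'⟩ := h2
    simp only at hN hD hD0 hc hN' hD' hD0' hc'
    have hE : (D - D').natDegree ≤ q :=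
      (Polynomial.natDegree_sub_le _ _).trans (max_le hD hD')
    have hz : (fun l : Fin q => (D - D').coeff (q - (l : ℕ))) = 0 := by
      refine Matrix.eq_zero_of_mulVec_eq_zero h ?_
      funext i
      have e := coeff_mul_eq_hankel a p q (D - D') hE i
      have z1 : N.coeff (p + 1 + i) = 0 :=
        Polynomial.coeff_eq_zero_of_natDegree_lt (by omega)
      have z2 : N'.coeff (p + 1 + i) = 0 :=
        Polynomial.coeff_eq_zero_of_natDegree_lt (by omega)
      have c1 := hc (p + 1 + i) (by have := i.2; omega)
      have c2 := hc' (p + 1 + i) (by have := i.2; omega)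
      rw [Polynomial.coeff_sub, hD0, hD0', sub_self, zero_mul, zero_add, Polynomial.coe_sub,
        sub_mul, map_sub, ← c1, ← c2, z1, z2, sub_self] at e
      simpa using e.symm
    have hDD : D = D' := by
      ext k
      rw [← sub_eq_zero, ← Polynomial.coeff_sub]
      rcases Nat.eq_zero_or_pos k with rfl | hk
      · rw [Polynomial.coeff_sub, hD0, hD0', sub_self]
      · by_cases hkq : k ≤ q
        · have := congrFun hz ⟨q - k, by omega⟩
          simpa [Nat.sub_sub_self hkq] using this
        · exact Polynomial.coeff_eq_zero_of_natDegree_lt (by omega)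
    subst hDD
    have hNN : N = N' := by
      ext k
      by_cases hk : k ≤ p + q
      · rw [hc k hk, hc' k hk]
      · rw [Polynomial.coeff_eq_zero_of_natDegree_lt (by omega),
          Polynomial.coeff_eq_zero_of_natDegree_lt (by omega)]
    rw [hNN]

open Classical in
/-- Numerator and denominator of the `[p/q]` Padé approximant of `a`; this is the unique pair
with `IsPadeApproximant a p q` whenever the Hankel determinant is nonzero. -/
def padePair (a : ℂ⟦X⟧) (p q : ℕ) : ℂ[X] × ℂ[X] :=
  if h : ∃ P : ℂ[X] × ℂ[X], IsPadeApproximant a p q P.1 P.2 then h.choose else (0, 1)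

theorem padePair_spec (a : ℂ⟦X⟧) (p q : ℕ) (h : (hankelMatrix a p q).det ≠ 0) :
    IsPadeApproximant a p q (padePair a p q).1 (padePair a p q).2 := by
  have := (existsUnique_padeApproximant a p q h).exists
  rw [padePair, dif_pos this]
  exact this.choose_spec

/-- If the Hankel determinant is nonzero, numerator and denominator have no common zero: the zeros
of the denominator are exactly the poles of the Padé approximant. -/
theorem num_eval_ne_zero_of_den_eval_eq_zero (a : ℂ⟦X⟧) (p q : ℕ) (h : (hankelMatrix a p q).det ≠ 0)
    (N D : ℂ[X]) (hP : IsPadeApproximant a p q N D) (w : ℂ) (hD : D.eval w = 0) : N.eval w ≠ 0 := by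
  intro hN
  obtain ⟨N', rfl⟩ := Polynomial.dvd_iff_isRoot.2 hN
  obtain ⟨D', rfl⟩ := Polynomial.dvd_iff_isRoot.2 hD
  obtain ⟨h1,h2,h3,h4⟩ := hP
  have hD0 : D' ≠ 0 := by rintro rfl; simp at h3
  have h3' : -w * D'.coeff 0 = 1 := by simpa [Polynomial.mul_coeff_zero] using h3
  have hw : w ≠ 0 := by rintro rfl; simp at h3'
  have hX : (Polynomial.X - Polynomial.C w) ≠ 0 := Polynomial.X_sub_C_ne_zero w
  have hc : D'.coeff 0 ≠ 0 := by intro h; simp [h] at h3'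
  have hQ : IsPadeApproximant a p q (Polynomial.C (-w) * N') (Polynomial.C (-w) * D') := by
    refine ⟨?_, ?_, ?_, ?_⟩
    · refine (Polynomial.natDegree_C_mul_le _ _).trans (le_trans ?_ h1)
      by_cases hz : N' = 0
      · simp [hz]
      · rw [Polynomial.natDegree_mul hX hz]; omega
    · refine (Polynomial.natDegree_C_mul_le _ _).trans (le_trans ?_ h2)
      rw [Polynomial.natDegree_mul hX hD0]; omega
    · simpa using h3'
    · intro v hv
      rw [← h4 v hv]
      congr 1
      have k1 : PowerSeries.constantCoeff ((Polynomial.C (-w) * D' : ℂ[X]) : ℂ⟦X⟧) ≠ 0 := by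
        rw [← PowerSeries.coeff_zero_eq_constantCoeff_apply, Polynomial.coeff_coe]; simp [hw, hc]
      have k2 : PowerSeries.constantCoeff (((Polynomial.X - Polynomial.C w) * D' : ℂ[X]) : ℂ⟦X⟧) ≠ 0 := by
        rw [← PowerSeries.coeff_zero_eq_constantCoeff_apply, Polynomial.coeff_coe]; simp [hw, hc, Polynomial.mul_coeff_zero]
      rw [PowerSeries.eq_mul_inv_iff_mul_eq k2, mul_right_comm, eq_comm, PowerSeries.eq_mul_inv_iff_mul_eq k1]
      simp only [Polynomial.coe_mul]; ring
  have := (existsUnique_padeApproximant a p q h).unique (y₁ := (_, _)) (y₂ := (_, _)) hQ ⟨h1,h2,h3,h4⟩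
  have := (Prod.ext_iff.1 this).2
  simp only at this
  have := mul_right_cancel₀ hD0 this
  have := congrArg (Polynomial.coeff · 1) this
  simp at this

/-- Values of a function on an open set, extended by `0` to the whole plane. -/
def extendZero {Ω : TopologicalSpace.Opens ℂ} (f : Ω → ℂ) : ℂ → ℂ :=
  Function.extend Subtype.val f 0

/-- The space `H(Ω)` of holomorphic functions on the open set `Ω`. As a subspace of `C(Ω, ℂ)` it
carries the compact-open topology, that is, the topology of uniform convergence on the compact
subsets of `Ω`. -/
abbrev HolomorphicFunctions (Ω : TopologicalSpace.Opens ℂ) : Type :=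
  {f : C(Ω, ℂ) // DifferentiableOn ℂ (extendZero f) (Ω : Set ℂ)}

/-- The Taylor series of `f` at the centre `ζ`, in powers of `z - ζ`. -/
def taylorSeries {Ω : TopologicalSpace.Opens ℂ} (f : HolomorphicFunctions Ω) (ζ : Ω) : ℂ⟦X⟧ :=
  PowerSeries.mk fun v => iteratedDeriv v (extendZero f.1) (ζ : ℂ) / (v.factorial : ℂ)

/-- `f ∈ 𝒟_{p,q}(ζ)`: the Hankel determinant of the Taylor series of `f` at `ζ` is nonzero. -/
def MemPadeClass {Ω : TopologicalSpace.Opens ℂ} (f : HolomorphicFunctions Ω) (p q : ℕ) (ζ : Ω) :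
    Prop :=
  (hankelMatrix (taylorSeries f ζ) p q).det ≠ 0

open Classical in
/-- The error `|[p/q]_{f,ζ}(z) - f(z)|`, equal to `∞` at the zeros of the denominator. If
`f ∈ 𝒟_{p,q}(ζ)`, these zeros are exactly the poles of `[p/q]_{f,ζ}`. -/
def padeError {Ω : TopologicalSpace.Opens ℂ} (f : HolomorphicFunctions Ω) (p q : ℕ) (ζ z : Ω) :
    ℝ≥0∞ :=
  let P := padePair (taylorSeries f ζ) p q
  if P.2.eval ((z : ℂ) - ζ) = 0 then ⊤
  else ‖P.1.eval ((z : ℂ) - ζ) / P.2.eval ((z : ℂ) - ζ) - f.1 z‖ₑ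

/-- There is one sequence `(pₙ, qₙ)` in `ℱ` such that, for every compact `K ⊆ Ω`, eventually
`f ∈ 𝒟_{pₙ,qₙ}(ζ)` for all `ζ ∈ K`, and
`sup_{ζ ∈ K} sup_{z ∈ K} |[pₙ/qₙ]_{f,ζ}(z) - f(z)| → 0`. -/
def IsApproximatedByPade {Ω : TopologicalSpace.Opens ℂ} (ℱ : Set (ℕ × ℕ))
    (f : HolomorphicFunctions Ω) : Prop :=
  ∃ p q : ℕ → ℕ, (∀ n, (p n, q n) ∈ ℱ) ∧
    ∀ K : Set Ω, IsCompact K →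
      (∃ n₀ : ℕ, ∀ n ≥ n₀, ∀ ζ ∈ K, MemPadeClass f (p n) (q n) ζ) ∧
      Tendsto (fun n => ⨆ ζ ∈ K, ⨆ z ∈ K, padeError f (p n) (q n) ζ z) atTop (𝓝 0)

end

/-! The proof is by Baire category in the complete metrizable space H(Ω). Along a compact exhaustion
Kₙ, a diagonal choice of types shows that the good functions are exactly ⋂ₙ ⋃_{(p,q) ∈ ℱ} of the
sets where, on Kₙ × Kₙ, the Hankel determinants are nonzero and the errors are below 1/n
(`setOf_isApproximatedByPade_eq`).

Each of these sets is open: Taylor coefficients depend continuously on (f, ζ) jointly, the Padé pair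
solves a linear system that is invertible where the Hankel determinant is nonzero, and Kₙ × Kₙ is
compact (`isOpen_setOf_forall_padeError_lt`).

For density, Runge's theorem approximates f by A/B with no poles in Ω, and A/B may be taken in
lowest terms. Adding δ zᵏ makes the numerator degree exactly p for some (p, q) ∈ ℱ with q ≥ deg B.
Such a fraction has nonzero Hankel determinant at every centre in Ω and is its own Padé approximant
there (`pade_eq_of_rational`), so a single function lies in the union for every n.

Runge's theorem itself comes from the Cauchy–Pompeiu formula, which reduces it to Cauchy kernels,
and from the spectrum of the coordinate function in a closed subalgebra of C(K), which replaces pole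
pushing. -/

/-! ### Padé approximants of rational series -/

/-- A kernel vector of the Hankel matrix is a polynomial E ≠ 0 with E(0) = 0, deg E ≤ q and E a ≡ M
modulo X^(p+q+1), where deg M ≤ p. Multiplying by D gives E N = M D, so by coprimality E = D G and M
= G N. Since deg N is exactly p, G is constant, and E(0) = 0 ≠ D(0) forces G = 0. -/
theorem hankelMatrix_det_ne_zero_of_mul_eq {a : ℂ⟦X⟧} {p q : ℕ} {N D : ℂ[X]}
    (hcop : IsCoprime N D) (hN0 : N ≠ 0) (hN : N.natDegree = p) (hD : D.natDegree ≤ q)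
    (hD0 : D.coeff 0 ≠ 0) (h : (D : ℂ⟦X⟧) * a = N) : (hankelMatrix a p q).det ≠ 0 := by
  intro hdet
  obtain ⟨x, hx0, hx⟩ := Matrix.exists_mulVec_eq_zero_iff.2 hdet
  set E : ℂ[X] := ∑ l : Fin q, Polynomial.monomial (q - (l : ℕ)) (x l) with hE
  have hEdeg : E.natDegree ≤ q :=
    Polynomial.natDegree_sum_le_of_forall_le _ _ fun l _ =>
      (Polynomial.natDegree_monomial_le _).trans (Nat.sub_le _ _)
  have hE0 : E.coeff 0 = 0 := by
    rw [hE, Polynomial.finsetSum_coeff]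
    refine Finset.sum_eq_zero fun l _ => ?_
    rw [Polynomial.coeff_monomial, if_neg]
    have := l.2
    omega
  have hco : (fun l : Fin q => E.coeff (q - (l : ℕ))) = x := by
    funext m
    rw [hE, Polynomial.finsetSum_coeff, Finset.sum_eq_single m]
    · simp
    · intro b _ hb
      rw [Polynomial.coeff_monomial, if_neg]
      have h1 := b.2
      have h2 := m.2
      exact fun h3 => hb (Fin.ext (by omega))
    · simp
  have hEne : E ≠ 0 := by
    intro h0
    apply hx0
    rw [← hco, h0]
    rfl
  set M : ℂ[X] := PowerSeries.trunc (p + 1) ((E : ℂ⟦X⟧) * a) with hM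
  have hMdeg : M.natDegree ≤ p := Nat.lt_succ_iff.1 (PowerSeries.natDegree_trunc_lt _ _)
  have hdvd : (PowerSeries.X : ℂ⟦X⟧) ^ (p + q + 1) ∣ (E : ℂ⟦X⟧) * a - M := by
    rw [PowerSeries.X_pow_dvd_iff]
    intro v hv
    rw [map_sub, Polynomial.coeff_coe, hM, PowerSeries.coeff_trunc]
    split_ifs with hvp
    · exact sub_self _
    · obtain ⟨i, rfl⟩ := Nat.exists_eq_add_of_le (not_lt.1 hvp)
      have := coeff_mul_eq_hankel a p q E hEdeg ⟨i, by omega⟩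
      rw [hco, hx, hE0] at this
      simpa using this
  have hdvd2 : (PowerSeries.X : ℂ⟦X⟧) ^ (p + q + 1) ∣ ((E * N - M * D : ℂ[X]) : ℂ⟦X⟧) := by
    have := hdvd.mul_left (D : ℂ⟦X⟧)
    convert this using 1
    push_cast
    linear_combination (-(E : ℂ⟦X⟧)) * h
  -- Both products have degree at most p + q, so a congruence modulo X^(p+q+1) is an equality.
  have heq : E * N = M * D := by
    rw [← sub_eq_zero]
    ext v
    rw [Polynomial.coeff_zero]
    by_cases hv : v < p + q + 1
    · rw [← Polynomial.coeff_coe]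
      exact PowerSeries.X_pow_dvd_iff.1 hdvd2 v hv
    · have h1 : (E * N).natDegree ≤ p + q := Polynomial.natDegree_mul_le.trans (by omega)
      have h2 : (M * D).natDegree ≤ p + q := Polynomial.natDegree_mul_le.trans (by omega)
      have h3 := (Polynomial.natDegree_sub_le (E * N) (M * D)).trans (max_le h1 h2)
      exact Polynomial.coeff_eq_zero_of_natDegree_lt (by omega)
  have hDE : D ∣ E := hcop.symm.dvd_of_dvd_mul_right ⟨M, by rw [heq, mul_comm]⟩
  obtain ⟨G, hG⟩ := hDE
  have hDne : D ≠ 0 := by rintro rfl; simp at hD0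
  have hG0 : G ≠ 0 := by rintro rfl; exact hEne (by rw [hG, mul_zero])
  have hMG : M = G * N := by
    apply mul_right_cancel₀ hDne
    rw [← heq, hG]
    ring
  have hGdeg : G.natDegree = 0 := by
    rw [hMG, Polynomial.natDegree_mul hG0 hN0] at hMdeg
    omega
  rw [Polynomial.eq_C_of_natDegree_eq_zero hGdeg] at hG
  have : D.coeff 0 * G.coeff 0 = 0 := by
    rw [← hE0, hG, Polynomial.mul_coeff_zero, Polynomial.coeff_C_zero]
  have hGc : G.coeff 0 = 0 := (mul_eq_zero.1 this).resolve_left hD0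
  exact hG0 (by rw [Polynomial.eq_C_of_natDegree_eq_zero hGdeg, hGc, Polynomial.C_0])

theorem padePair_eq {a : ℂ⟦X⟧} {p q : ℕ} {N D : ℂ[X]} (h : (hankelMatrix a p q).det ≠ 0)
    (hP : IsPadeApproximant a p q N D) : padePair a p q = (N, D) :=
  (existsUnique_padeApproximant a p q h).unique (padePair_spec a p q h) hP

theorem isPadeApproximant_of_mul_eq {a : ℂ⟦X⟧} {p q : ℕ} {N D : ℂ[X]} (hN : N.natDegree ≤ p)
    (hD : D.natDegree ≤ q) (hD0 : D.coeff 0 ≠ 0) (h : (D : ℂ⟦X⟧) * a = N) :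
    IsPadeApproximant a p q (Polynomial.C (D.coeff 0)⁻¹ * N) (Polynomial.C (D.coeff 0)⁻¹ * D) := by
  rw [isPadeApproximant_iff]
  refine ⟨(Polynomial.natDegree_C_mul_le _ _).trans hN, (Polynomial.natDegree_C_mul_le _ _).trans hD,
    ?_, fun v _ => ?_⟩
  · rw [Polynomial.coeff_C_mul, inv_mul_cancel₀ hD0]
  · rw [Polynomial.coe_mul, mul_assoc, h, ← Polynomial.coe_mul, Polynomial.coeff_coe]

/-! ### The topology of H(Ω) and continuity of Taylor coefficients -/

section HolomorphicTopology

variable {Ω : TopologicalSpace.Opens ℂ}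

theorem extendZero_apply (f : Ω → ℂ) (z : Ω) : extendZero f z = f z :=
  Subtype.val_injective.extend_apply f 0 z

theorem extendZero_of_mem (f : Ω → ℂ) {z : ℂ} (hz : z ∈ Ω) : extendZero f z = f ⟨z, hz⟩ :=
  extendZero_apply f ⟨z, hz⟩

theorem tendsto_iff_tendstoLocallyUniformlyOn_extendZero {ι : Type*} {l : Filter ι}
    {F : ι → C(Ω, ℂ)} {f : C(Ω, ℂ)} :
    Tendsto F l (𝓝 f) ↔
      TendstoLocallyUniformlyOn (fun i => extendZero (F i)) (extendZero f) l (Ω : Set ℂ) := by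
  have : LocallyCompactSpace Ω := Ω.isOpen.locallyCompactSpace
  rw [ContinuousMap.tendsto_iff_tendstoLocallyUniformly,
    tendstoLocallyUniformlyOn_iff_tendstoLocallyUniformly_comp_coe]
  have h1 : (fun i (x : Ω) => extendZero (F i) (x : ℂ)) = fun i x => F i x := by
    funext i x; exact extendZero_apply _ x
  have h2 : (extendZero f ∘ (Subtype.val : Ω → ℂ)) = f := by
    funext x; exact extendZero_apply _ x
  exact Iff.of_eq (congrArg₂ (fun a b => TendstoLocallyUniformly a b l) h1.symm h2.symm)

theorem isClosed_setOf_differentiableOn_extendZero :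
    IsClosed {f : C(Ω, ℂ) | DifferentiableOn ℂ (extendZero f) (Ω : Set ℂ)} := by
  rw [isClosed_iff_forall_filter]
  intro f l hl hlS hlf
  exact (tendsto_iff_tendstoLocallyUniformlyOn_extendZero.1 hlf).differentiableOn
    (le_principal_iff.1 hlS) Ω.isOpen

theorem differentiableOn_iteratedDeriv {f : ℂ → ℂ} {U : Set ℂ} (hU : IsOpen U)
    (hf : DifferentiableOn ℂ f U) (v : ℕ) : DifferentiableOn ℂ (iteratedDeriv v f) U := by
  induction v with
  | zero => simpa using hf
  | succ n ih => rw [iteratedDeriv_succ]; exact ih.deriv hU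

theorem tendstoLocallyUniformlyOn_iteratedDeriv (f : HolomorphicFunctions Ω) (v : ℕ) :
    TendstoLocallyUniformlyOn (fun g : HolomorphicFunctions Ω => iteratedDeriv v (extendZero g.1))
      (iteratedDeriv v (extendZero f.1)) (𝓝 f) (Ω : Set ℂ) := by
  induction v with
  | zero =>
    simp only [iteratedDeriv_zero]
    exact tendsto_iff_tendstoLocallyUniformlyOn_extendZero.1 continuous_subtype_val.continuousAt
  | succ n ih =>
    simp only [iteratedDeriv_succ]
    exact ih.deriv (Eventually.of_forall fun g => differentiableOn_iteratedDeriv Ω.isOpen g.2 n)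
      Ω.isOpen

/-- Derivatives converge locally uniformly (Weierstrass) and the limit is continuous in the point.
Joint continuity in function and centre is what the later compactness argument over centres needs.
-/
theorem continuous_iteratedDeriv_extendZero (v : ℕ) :
    Continuous fun x : HolomorphicFunctions Ω × Ω =>
      iteratedDeriv v (extendZero x.1.1) (x.2 : ℂ) := by
  rw [continuous_iff_continuousAt]
  rintro ⟨f, ζ⟩
  refine tendsto_comp_of_locally_uniform_limit_within (s := (Ω : Set ℂ))
    (f := iteratedDeriv v (extendZero f.1)) (g := fun x : HolomorphicFunctions Ω × Ω => (x.2 : ℂ))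
    ((differentiableOn_iteratedDeriv Ω.isOpen f.2 v).continuousOn ζ ζ.2) ?_ ?_
  · refine tendsto_nhdsWithin_iff.2 ⟨?_, Eventually.of_forall fun x => x.2.2⟩
    exact (continuous_subtype_val.comp continuous_snd).continuousAt
  · intro u hu
    obtain ⟨t, ht, h⟩ := tendstoLocallyUniformlyOn_iteratedDeriv f v u hu ζ ζ.2
    exact ⟨t, ht, (continuous_fst.tendsto (f, ζ)).eventually h⟩

theorem continuous_coeff_taylorSeries (v : ℕ) :
    Continuous fun x : HolomorphicFunctions Ω × Ω =>
      PowerSeries.coeff v (taylorSeries x.1 x.2) := by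
  simp only [taylorSeries, PowerSeries.coeff_mk]
  exact (continuous_iteratedDeriv_extendZero v).div_const _

theorem continuous_holomorphic_eval :
    Continuous fun x : HolomorphicFunctions Ω × Ω => x.1.1 x.2 := by
  refine (continuous_iteratedDeriv_extendZero 0).congr fun x => ?_
  rw [iteratedDeriv_zero, extendZero_apply]

end HolomorphicTopology

/-! ### Continuous dependence of the Padé pair on the series -/

section PadeContinuity

variable {Y : Type*} [TopologicalSpace Y] {a : Y → ℂ⟦X⟧} {p q : ℕ}

theorem continuous_coeffZ (ha : ∀ v, Continuous fun y => PowerSeries.coeff v (a y)) (k : ℤ) :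
    Continuous fun y => coeffZ (a y) k := by
  simp only [coeffZ]
  split_ifs
  · exact ha _
  · exact continuous_const

theorem continuous_hankelMatrix (ha : ∀ v, Continuous fun y => PowerSeries.coeff v (a y)) :
    Continuous fun y => hankelMatrix (a y) p q :=
  continuous_matrix fun _ _ => continuous_coeffZ ha _

/-- The numerator has no coefficients in degrees p + 1, …, p + q, which is a linear system for the
denominator. Solving it explicitly makes the dependence on the series visibly continuous. -/
theorem padePair_den_coeff_eq {b : ℂ⟦X⟧} (h : (hankelMatrix b p q).det ≠ 0) :
    (fun l : Fin q => (padePair b p q).2.coeff (q - l)) =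
      (hankelMatrix b p q)⁻¹.mulVec (fun i : Fin q => -PowerSeries.coeff (p + 1 + i) b) := by
  have hP := (isPadeApproximant_iff _ _ _ _ _).1 (padePair_spec b p q h)
  obtain ⟨hN, hD, hD0, hc⟩ := hP
  have key : (hankelMatrix b p q).mulVec (fun l : Fin q => (padePair b p q).2.coeff (q - l)) =
      fun i : Fin q => -PowerSeries.coeff (p + 1 + i) b := by
    funext i
    have e := coeff_mul_eq_hankel b p q _ hD i
    rw [← hc _ (by have := i.2; omega), hD0,
      Polynomial.coeff_eq_zero_of_natDegree_lt (show _ < p + 1 + (i : ℕ) by omega)] at e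
    linear_combination -e
  rw [← key, Matrix.mulVec_mulVec, Matrix.nonsing_inv_mul _ (isUnit_iff_ne_zero.2 h),
    Matrix.one_mulVec]

theorem continuousAt_padePair_den_coeff {y : Y}
    (ha : ∀ v, Continuous fun y => PowerSeries.coeff v (a y))
    (h : (hankelMatrix (a y) p q).det ≠ 0) (k : ℕ) :
    ContinuousAt (fun y => (padePair (a y) p q).2.coeff k) y := by
  have hev : ∀ᶠ y' in 𝓝 y, (hankelMatrix (a y') p q).det ≠ 0 :=
    (continuous_hankelMatrix ha).matrix_det.continuousAt.eventually_ne h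
  by_cases hk0 : k = 0
  · subst hk0
    refine continuousAt_const.congr (f := fun _ => (1 : ℂ)) ?_
    filter_upwards [hev] with y' hy'
    exact ((padePair_spec _ p q hy').den_coeff_zero).symm
  by_cases hkq : q < k
  · refine continuousAt_const.congr (f := fun _ => (0 : ℂ)) ?_
    filter_upwards [hev] with y' hy'
    exact (Polynomial.coeff_eq_zero_of_natDegree_lt
      ((padePair_spec _ p q hy').natDegree_den_le.trans_lt hkq)).symm
  · have hinv : ContinuousAt (fun y => (hankelMatrix (a y) p q)⁻¹) y := by
      refine ContinuousAt.comp (g := Inv.inv) (continuousAt_matrix_inv _ ?_)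
        (continuous_hankelMatrix ha).continuousAt
      rw [Ring.inverse_eq_inv']
      exact continuousAt_inv₀ h
    have hvec : ContinuousAt (fun y => (hankelMatrix (a y) p q)⁻¹.mulVec
        (fun i : Fin q => -PowerSeries.coeff (p + 1 + i) (a y))) y := by
      have hmv : Continuous fun x : Matrix (Fin q) (Fin q) ℂ × (Fin q → ℂ) => x.1.mulVec x.2 :=
        continuous_fst.matrix_mulVec continuous_snd
      exact hmv.continuousAt.comp (f := fun y => ((hankelMatrix (a y) p q)⁻¹,
        (fun i : Fin q => -PowerSeries.coeff (p + 1 + i) (a y))))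
        (hinv.prodMk (continuous_pi fun i => (ha _).neg).continuousAt)
    have hl : q - k < q := by omega
    refine ((continuousAt_pi.1 hvec) ⟨q - k, hl⟩).congr ?_
    filter_upwards [hev] with y' hy'
    rw [← padePair_den_coeff_eq hy']
    have e : q - (q - k) = k := by omega
    simp only [e]

theorem continuousAt_padePair_num_coeff {y : Y}
    (ha : ∀ v, Continuous fun y => PowerSeries.coeff v (a y))
    (h : (hankelMatrix (a y) p q).det ≠ 0) (k : ℕ) :
    ContinuousAt (fun y => (padePair (a y) p q).1.coeff k) y := by
  have hev : ∀ᶠ y' in 𝓝 y, (hankelMatrix (a y') p q).det ≠ 0 :=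
    (continuous_hankelMatrix ha).matrix_det.continuousAt.eventually_ne h
  by_cases hk : k ≤ p
  · have hc : ContinuousAt (fun y => ∑ x ∈ Finset.HasAntidiagonal.antidiagonal k,
        (padePair (a y) p q).2.coeff x.1 * PowerSeries.coeff x.2 (a y)) y :=
      tendsto_finsetSum _ fun x _ =>
        (continuousAt_padePair_den_coeff ha h x.1).mul (ha x.2).continuousAt
    refine hc.congr ?_
    filter_upwards [hev] with y' hy'
    rw [((isPadeApproximant_iff _ _ _ _ _).1 (padePair_spec _ p q hy')).2.2.2 k (by omega),
      PowerSeries.coeff_mul]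
    simp only [Polynomial.coeff_coe]
  · refine continuousAt_const.congr (f := fun _ => (0 : ℂ)) ?_
    filter_upwards [hev] with y' hy'
    exact (Polynomial.coeff_eq_zero_of_natDegree_lt
      ((padePair_spec _ p q hy').natDegree_num_le.trans_lt (by omega))).symm

/-- The degree bound near y turns evaluation into a sum of fixed length; coefficientwise continuity
alone would not suffice. -/
theorem continuousAt_polynomial_eval {P : Y → ℂ[X]} {w : Y → ℂ} {y : Y} {n : ℕ}
    (hdeg : ∀ᶠ y in 𝓝 y, (P y).natDegree ≤ n)
    (hP : ∀ k, ContinuousAt (fun y => (P y).coeff k) y) (hw : ContinuousAt w y) :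
    ContinuousAt (fun y => (P y).eval (w y)) y := by
  have hc : ContinuousAt (fun y => ∑ k ∈ Finset.range (n + 1), (P y).coeff k * w y ^ k) y :=
    tendsto_finsetSum _ fun k _ => (hP k).mul (hw.pow k)
  refine hc.congr ?_
  filter_upwards [hdeg] with y' hy'
  rw [Polynomial.eval_eq_sum_range' (Nat.lt_succ_of_le hy')]

theorem eventually_padeApproximant_sub_lt {y : Y} {w g : Y → ℂ} {ε : ℝ≥0∞}
    (ha : ∀ v, Continuous fun y => PowerSeries.coeff v (a y)) (hw : Continuous w)
    (hg : Continuous g) (h : (hankelMatrix (a y) p q).det ≠ 0)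
    (hD0 : (padePair (a y) p q).2.eval (w y) ≠ 0)
    (hε : ‖(padePair (a y) p q).1.eval (w y) / (padePair (a y) p q).2.eval (w y) - g y‖ₑ < ε) :
    ∀ᶠ y in 𝓝 y, (hankelMatrix (a y) p q).det ≠ 0 ∧ (padePair (a y) p q).2.eval (w y) ≠ 0 ∧
      ‖(padePair (a y) p q).1.eval (w y) / (padePair (a y) p q).2.eval (w y) - g y‖ₑ < ε := by
  have hev : ∀ᶠ y' in 𝓝 y, (hankelMatrix (a y') p q).det ≠ 0 :=
    (continuous_hankelMatrix ha).matrix_det.continuousAt.eventually_ne h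
  have hD := continuousAt_polynomial_eval (n := q)
    (hev.mono fun x hx => (padePair_spec _ p q hx).natDegree_den_le)
    (continuousAt_padePair_den_coeff ha h) hw.continuousAt
  have hN := continuousAt_polynomial_eval (n := p)
    (hev.mono fun x hx => (padePair_spec _ p q hx).natDegree_num_le)
    (continuousAt_padePair_num_coeff ha h) hw.continuousAt
  have herr := ((hN.div hD hD0).sub hg.continuousAt).enorm.eventually_lt_const hε
  filter_upwards [hev, hD.eventually_ne hD0, herr] with x h1 h2 h3
  exact ⟨h1, h2, h3⟩

end PadeContinuity

/-! ### Openness of the approximation conditions -/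

section HolomorphicApproximation

variable {Ω : TopologicalSpace.Opens ℂ}

theorem padeError_lt_iff {f : HolomorphicFunctions Ω} {p q : ℕ} {ζ z : Ω} {ε : ℝ≥0∞} :
    padeError f p q ζ z < ε ↔
      (padePair (taylorSeries f ζ) p q).2.eval ((z : ℂ) - ζ) ≠ 0 ∧
      ‖(padePair (taylorSeries f ζ) p q).1.eval ((z : ℂ) - ζ) /
        (padePair (taylorSeries f ζ) p q).2.eval ((z : ℂ) - ζ) - f.1 z‖ₑ < ε := by
  rw [padeError]
  split_ifs with h
  · simp [h]
  · simp [h]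

theorem eventually_padeError_lt {p q : ℕ} {ε : ℝ≥0∞} {x : HolomorphicFunctions Ω × Ω × Ω}
    (h : MemPadeClass x.1 p q x.2.1) (herr : padeError x.1 p q x.2.1 x.2.2 < ε) :
    ∀ᶠ x : HolomorphicFunctions Ω × Ω × Ω in 𝓝 x,
      MemPadeClass x.1 p q x.2.1 ∧ padeError x.1 p q x.2.1 x.2.2 < ε := by
  rw [padeError_lt_iff] at herr
  have ha : ∀ v, Continuous fun x : HolomorphicFunctions Ω × Ω × Ω =>
      PowerSeries.coeff v (taylorSeries x.1 x.2.1) := fun v =>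
    (continuous_coeff_taylorSeries v).comp
      (f := fun x : HolomorphicFunctions Ω × Ω × Ω => (x.1, x.2.1))
      (continuous_fst.prodMk (continuous_fst.comp continuous_snd))
  have hw : Continuous fun x : HolomorphicFunctions Ω × Ω × Ω => (x.2.2 : ℂ) - x.2.1 :=
    (continuous_subtype_val.comp (continuous_snd.comp continuous_snd)).sub
      (continuous_subtype_val.comp (continuous_fst.comp continuous_snd))
  have hf : Continuous fun x : HolomorphicFunctions Ω × Ω × Ω => x.1.1 x.2.2 :=
    continuous_holomorphic_eval.comp
      (f := fun x : HolomorphicFunctions Ω × Ω × Ω => (x.1, x.2.2))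
      (continuous_fst.prodMk (continuous_snd.comp continuous_snd))
  refine (eventually_padeApproximant_sub_lt ha hw hf h herr.1 herr.2).mono fun x' hx' => ?_
  exact ⟨hx'.1, padeError_lt_iff.2 hx'.2⟩

theorem isOpen_setOf_forall_padeError_lt {K : Set Ω} (hK : IsCompact K) (p q : ℕ) (ε : ℝ≥0∞) :
    IsOpen {f : HolomorphicFunctions Ω |
      ∀ x ∈ K ×ˢ K, MemPadeClass f p q x.1 ∧ padeError f p q x.1 x.2 < ε} := by
  rw [isOpen_iff_eventually]
  intro f hf
  -- Tube lemma: neighbourhoods of (f, x) for each x in the compact set K × K yield one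
  -- neighbourhood of f.
  exact (hK.prod hK).eventually_forall_of_forall_eventually fun x hx =>
    eventually_padeError_lt (hf x hx).1 (hf x hx).2

/-! ### Rational functions equal to their Padé approximants -/

theorem iteratedDeriv_polynomial_eval (P : ℂ[X]) (v : ℕ) :
    iteratedDeriv v (fun z => P.eval z) = fun z => ((Polynomial.derivative^[v]) P).eval z := by
  induction v with
  | zero => simp
  | succ n ih =>
    rw [iteratedDeriv_succ, ih]
    funext z
    rw [Polynomial.deriv, Function.iterate_succ_apply']

theorem iteratedDeriv_polynomial_eval_div_factorial (P : ℂ[X]) (v : ℕ) (ζ : ℂ) :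
    iteratedDeriv v (fun z => P.eval z) ζ / (v.factorial : ℂ) = (Polynomial.taylor ζ P).coeff v := by
  have hs : (Polynomial.derivative^[v]) P = v.factorial • Polynomial.hasseDeriv v P := by
    rw [← Polynomial.factorial_smul_hasseDeriv]
    rfl
  rw [iteratedDeriv_polynomial_eval, Polynomial.taylor_coeff, hs]
  simp only [nsmul_eq_mul, Polynomial.eval_natCast_mul]
  have := Nat.factorial_ne_zero v
  field_simp

/-- This is Leibniz's rule for B f = A at ζ, divided by v!. -/
theorem taylor_mul_taylorSeries {f : HolomorphicFunctions Ω} {A B : ℂ[X]}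
    (h : ∀ z : Ω, B.eval (z : ℂ) * f.1 z = A.eval (z : ℂ)) (ζ : Ω) :
    ((Polynomial.taylor (ζ : ℂ) B : ℂ[X]) : ℂ⟦X⟧) * taylorSeries f ζ =
      (Polynomial.taylor (ζ : ℂ) A : ℂ[X]) := by
  ext v
  have hf : ContDiffAt ℂ v (extendZero f.1) (ζ : ℂ) :=
    (f.2.analyticAt (Ω.isOpen.mem_nhds ζ.2)).contDiffAt
  have hB : ContDiffAt ℂ v (fun z => B.eval z) (ζ : ℂ) := by
    simpa using (Polynomial.contDiff_aeval B v).contDiffAt (x := (ζ : ℂ))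
  have hev : (fun z => B.eval z) * extendZero f.1 =ᶠ[𝓝 (ζ : ℂ)] fun z => A.eval z := by
    filter_upwards [Ω.isOpen.mem_nhds ζ.2] with z hz
    rw [Pi.mul_apply, extendZero_of_mem _ hz, h ⟨z, hz⟩]
  have key := iteratedDeriv_mul hB hf
  rw [hev.iteratedDeriv_eq] at key
  rw [Polynomial.coeff_coe, ← iteratedDeriv_polynomial_eval_div_factorial, key, Finset.sum_div,
    PowerSeries.coeff_mul, Finset.Nat.sum_antidiagonal_eq_sum_range_succ_mk]
  refine Finset.sum_congr rfl fun k hk => ?_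
  have hk : k ≤ v := Nat.lt_succ_iff.1 (Finset.mem_range.1 hk)
  rw [Polynomial.coeff_coe, ← iteratedDeriv_polynomial_eval_div_factorial, taylorSeries,
    PowerSeries.coeff_mk, Nat.cast_choose ℂ hk]
  have h1 := Nat.factorial_ne_zero v
  have h2 := Nat.factorial_ne_zero k
  have h3 := Nat.factorial_ne_zero (v - k)
  field_simp

theorem extendZero_eqOn {f : C(Ω, ℂ)} {g : ℂ → ℂ} (h : ∀ z : Ω, f z = g z) :
    Set.EqOn (extendZero f) g (Ω : Set ℂ) := fun z hz => by
  rw [extendZero_of_mem _ hz, h]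

def holomorphicOfDifferentiableOn (g : ℂ → ℂ) (hg : DifferentiableOn ℂ g (Ω : Set ℂ)) :
    HolomorphicFunctions Ω :=
  ⟨⟨fun z => g z, continuousOn_iff_continuous_domRestrict.1 hg.continuousOn⟩,
    hg.congr (extendZero_eqOn fun _ => rfl)⟩

/-- Recentring at ζ is an algebra automorphism of ℂ[X] preserving degrees, so the coprime pair meets
the determinant criterion at every centre. Uniqueness identifies the approximant with A/B, after
scaling the denominator to constant term 1. -/
theorem pade_eq_of_rational {f : HolomorphicFunctions Ω} {A B : ℂ[X]} {p q : ℕ}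
    (h : ∀ z : Ω, B.eval (z : ℂ) * f.1 z = A.eval (z : ℂ)) (hB : ∀ z : Ω, B.eval (z : ℂ) ≠ 0)
    (hcop : IsCoprime A B) (hA0 : A ≠ 0) (hA : A.natDegree = p) (hBq : B.natDegree ≤ q)
    (ζ z : Ω) : MemPadeClass f p q ζ ∧ padeError f p q ζ z = 0 := by
  have hmul := taylor_mul_taylorSeries h ζ
  have hN : (Polynomial.taylor (ζ : ℂ) A).natDegree = p := by rw [Polynomial.natDegree_taylor, hA]
  have hD : (Polynomial.taylor (ζ : ℂ) B).natDegree ≤ q := by rwa [Polynomial.natDegree_taylor]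
  have hD0 : (Polynomial.taylor (ζ : ℂ) B).coeff 0 ≠ 0 := by
    rw [Polynomial.taylor_coeff_zero]; exact hB ζ
  have hcop' : IsCoprime (Polynomial.taylor (ζ : ℂ) A) (Polynomial.taylor (ζ : ℂ) B) :=
    hcop.map (Polynomial.taylorAlgHom (ζ : ℂ)).toRingHom
  have hN0 : Polynomial.taylor (ζ : ℂ) A ≠ 0 := by
    rwa [Ne, Polynomial.taylor_eq_zero]
  have hdet := hankelMatrix_det_ne_zero_of_mul_eq hcop' hN0 hN hD hD0 hmul
  refine ⟨hdet, ?_⟩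
  have hpair := padePair_eq hdet (isPadeApproximant_of_mul_eq hN.le hD hD0 hmul)
  have hc := inv_ne_zero hD0
  have e : ∀ P : ℂ[X], (Polynomial.taylor (ζ : ℂ) P).eval ((z : ℂ) - ζ) = P.eval (z : ℂ) := by
    intro P; rw [Polynomial.taylor_eval]; congr 1; ring
  rw [padeError, hpair]
  simp only [Polynomial.eval_mul, Polynomial.eval_C, e]
  rw [if_neg (mul_ne_zero hc (hB z)), mul_div_mul_left _ _ hc, ← h z,
    mul_div_cancel_left₀ _ (hB z), sub_self, enorm_zero]

/-- Cancelling the gcd is harmless on Ω because it divides B. The condition `B ≠ 0` is kept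
separately since Ω may be empty. -/
theorem exists_coprime_of_rational {A B : ℂ[X]} (hB0 : B ≠ 0) (hB : ∀ z : Ω, B.eval (z : ℂ) ≠ 0) :
    ∃ A' B' : ℂ[X], IsCoprime A' B' ∧ B' ≠ 0 ∧ (∀ z : Ω, B'.eval (z : ℂ) ≠ 0) ∧
      ∀ z : Ω, A'.eval (z : ℂ) / B'.eval (z : ℂ) = A.eval (z : ℂ) / B.eval (z : ℂ) := by
  obtain ⟨G, A', B', hcop, rfl, rfl⟩ : ∃ G A' B' : ℂ[X], IsCoprime A' B' ∧
      A = G * A' ∧ B = G * B' := by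
    obtain ⟨A', hA⟩ := EuclideanDomain.gcd_dvd_left A B
    obtain ⟨B', hB'⟩ := EuclideanDomain.gcd_dvd_right A B
    refine ⟨_, A', B', ⟨EuclideanDomain.gcdA A B, EuclideanDomain.gcdB A B, ?_⟩, hA, hB'⟩
    have hG : EuclideanDomain.gcd A B ≠ 0 := by
      intro h0
      rw [h0, zero_mul] at hB'
      exact hB0 hB'
    apply mul_left_cancel₀ hG
    linear_combination (-EuclideanDomain.gcdA A B) * hA - EuclideanDomain.gcdB A B * hB' -
      EuclideanDomain.gcd_eq_gcd_ab A B
  have hz : ∀ z : Ω, G.eval (z : ℂ) ≠ 0 ∧ B'.eval (z : ℂ) ≠ 0 := by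
    intro z
    have := hB z
    rw [Polynomial.eval_mul] at this
    exact ⟨left_ne_zero_of_mul this, right_ne_zero_of_mul this⟩
  refine ⟨A', B', hcop, right_ne_zero_of_mul hB0, fun z => (hz z).2, fun z => ?_⟩
  rw [Polynomial.eval_mul, Polynomial.eval_mul, mul_div_mul_left _ _ (hz z).1]

/-- A rational function without poles in `Ω` is, up to a small multiple of a power of `z`, equal to
all its Padé approximants of some type in `ℱ`. -/
theorem exists_pade_eq_near_rational {ℱ : Set (ℕ × ℕ)}
    (hℱ : ∃ p q : ℕ → ℕ, (∀ n, (p n, q n) ∈ ℱ) ∧ Tendsto p atTop atTop ∧ Tendsto q atTop atTop)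
    {A B : ℂ[X]} (hB0 : B ≠ 0) (hB : ∀ z : Ω, B.eval (z : ℂ) ≠ 0) {R ε : ℝ} (hε : 0 < ε) :
    ∃ f : HolomorphicFunctions Ω, (∀ z : Ω, ‖(z : ℂ)‖ ≤ R →
      ‖f.1 z - A.eval (z : ℂ) / B.eval (z : ℂ)‖ < ε) ∧
      ∃ p q : ℕ, (p, q) ∈ ℱ ∧ ∀ ζ z : Ω, MemPadeClass f p q ζ ∧ padeError f p q ζ z = 0 := by
  obtain ⟨A', B', hcop, hB0', hB', hAB⟩ := exists_coprime_of_rational (A := A) hB0 hB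
  obtain ⟨p, q, hpq, hp, hq⟩ := hℱ
  -- The bound on `p n` makes the subtraction defining `k` genuine, lets the added term dominate the
  -- degree of `A'`, and excludes `p n = 0`.
  obtain ⟨n, hpn, hqn⟩ := ((hp.eventually_gt_atTop (A'.natDegree + B'.natDegree)).and
    (hq.eventually_ge_atTop B'.natDegree)).exists
  set k := p n - B'.natDegree with hk
  set M : ℝ := (max R 0) ^ k + 1 with hM
  have hM0 : 0 < M := by positivity
  set δ : ℝ := ε / M / 2 with hδ
  have hδ0 : 0 < δ := by positivity
  have hδC : (δ : ℂ) ≠ 0 := by exact_mod_cast hδ0.ne'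
  -- Adding a multiple of `B'` preserves coprimality and changes the fraction only by δ zᵏ; the
  -- choice of `k` gives degree exactly `p n`.
  set A₁ : ℂ[X] := A' + Polynomial.C (δ : ℂ) * Polynomial.X ^ k * B' with hA₁
  have hdeg : (Polynomial.C (δ : ℂ) * Polynomial.X ^ k * B').natDegree = p n := by
    rw [Polynomial.natDegree_mul (by simp [hδC]) hB0', Polynomial.natDegree_C_mul_X_pow k _ hδC]
    omega
  have hdegA₁ : A₁.natDegree = p n := by
    rw [hA₁, Polynomial.natDegree_add_eq_right_of_natDegree_lt, hdeg]
    rw [hdeg]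
    omega
  have hA₁0 : A₁ ≠ 0 := by
    intro h0
    rw [h0, Polynomial.natDegree_zero] at hdegA₁
    omega
  refine ⟨holomorphicOfDifferentiableOn (fun z => A₁.eval z / B'.eval z)
    (A₁.differentiable.differentiableOn.div B'.differentiable.differentiableOn
      fun z hz => hB' ⟨z, hz⟩), ?_, p n, q n, hpq n, ?_⟩
  · intro z hz
    change ‖A₁.eval (z : ℂ) / B'.eval (z : ℂ) - _‖ < ε
    have e : A₁.eval (z : ℂ) / B'.eval (z : ℂ) - A.eval (z : ℂ) / B.eval (z : ℂ) = δ * (z : ℂ) ^ k := by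
      rw [← hAB, hA₁]
      simp only [Polynomial.eval_add, Polynomial.eval_mul, Polynomial.eval_C, Polynomial.eval_pow,
        Polynomial.eval_X]
      rw [add_div, mul_div_cancel_right₀ _ (hB' z)]
      ring
    rw [e, norm_mul, norm_pow, Complex.norm_real, Real.norm_of_nonneg hδ0.le]
    have h1 : ‖(z : ℂ)‖ ^ k ≤ M := by
      have := pow_le_pow_left₀ (norm_nonneg (z : ℂ)) (hz.trans (le_max_left R 0)) k
      rw [hM]
      linarith
    calc δ * ‖(z : ℂ)‖ ^ k ≤ δ * M := by gcongr
      _ = ε / 2 := by rw [hδ]; field_simp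
      _ < ε := by linarith
  · refine pade_eq_of_rational (A := A₁) (B := B') (fun z => ?_) hB' ?_ hA₁0 hdegA₁ hqn
    · exact mul_div_cancel₀ _ (hB' z)
    · exact (IsCoprime.add_mul_right_left_iff).2 hcop

/-! ### The Cauchy–Pompeiu formula -/

section CauchyPompeiu

open MeasureTheory Complex Set

/-- Twice the Wirtinger derivative `∂/∂z̄`. -/
noncomputable def dbar (u : ℂ → ℂ) (w : ℂ) : ℂ := fderiv ℝ u w 1 + I * fderiv ℝ u w I

theorem dbar_eq_zero_of_differentiableAt {u : ℂ → ℂ} {w : ℂ} (h : DifferentiableAt ℂ u w) :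
    dbar u w = 0 := by
  have h1 : fderiv ℝ u w = (fderiv ℂ u w).restrictScalars ℝ := h.fderiv_restrictScalars ℝ
  have h2 : fderiv ℂ u w I = I * fderiv ℂ u w 1 := by
    rw [← smul_eq_mul, ← ContinuousLinearMap.map_smul, smul_eq_mul, mul_one]
  rw [dbar, h1]
  simp only [ContinuousLinearMap.coe_restrictScalars']
  rw [h2, ← mul_assoc, I_mul_I]
  ring

theorem continuous_dbar {u : ℂ → ℂ} (hu : ContDiff ℝ 1 u) : Continuous (dbar u) := by
  have := hu.continuous_fderiv one_ne_zero
  unfold dbar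
  fun_prop

/-- In polar coordinates about any centre, the right side is ∂u/∂r + (i/r) ∂u/∂θ. -/
theorem dbar_mul_exp_neg (u : ℂ → ℂ) (w : ℂ) (θ : ℝ) :
    dbar u w * exp (-(θ * I)) =
      fderiv ℝ u w (exp (θ * I)) + I * fderiv ℝ u w (I * exp (θ * I)) := by
  have e1 : exp (θ * I) = Real.cos θ • (1 : ℂ) + Real.sin θ • I := by
    rw [exp_mul_I, ← ofReal_cos, ← ofReal_sin, real_smul, real_smul, mul_one]
  have e2 : I * exp (θ * I) = (-Real.sin θ) • (1 : ℂ) + Real.cos θ • I := by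
    rw [e1, real_smul, real_smul, real_smul, real_smul]
    push_cast
    linear_combination sin (θ : ℂ) * I_mul_I
  have e3 : exp (-(θ * I)) = Real.cos θ - Real.sin θ * I := by
    rw [← neg_mul, ← ofReal_neg, exp_mul_I, ← ofReal_cos, ← ofReal_sin, Real.cos_neg, Real.sin_neg]
    push_cast
    ring
  rw [e2, e1, e3, map_add, map_add, map_smul, map_smul, map_smul, map_smul, dbar]
  simp only [real_smul]
  push_cast
  linear_combination -sin (θ : ℂ) * fderiv ℝ u w I * I_mul_I

variable {u : ℂ → ℂ}

theorem exists_pos_eq_zero_of_lt_norm (hc : HasCompactSupport u) (z : ℂ) :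
    ∃ R : ℝ, 0 < R ∧ ∀ r : ℝ, R < r → ∀ θ : ℝ,
      z + r * exp (θ * I) ∉ tsupport u := by
  obtain ⟨R, hR⟩ := hc.isBounded.exists_norm_le
  refine ⟨max 1 (R + ‖z‖), by positivity, fun r hr θ hmem => ?_⟩
  have h1 := hR _ hmem
  have h2 : ‖(r : ℂ) * exp (θ * I)‖ = r := by
    rw [norm_mul, norm_exp_ofReal_mul_I, mul_one, norm_real, Real.norm_of_nonneg]
    exact (zero_le_one.trans (le_max_left _ _)).trans hr.le
  have h3 : ‖(r : ℂ) * exp (θ * I)‖ ≤ ‖z + r * exp (θ * I)‖ + ‖z‖ := by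
    have := norm_sub_le (z + r * exp (θ * I)) z
    rwa [add_sub_cancel_left] at this
  have h4 := (le_max_right 1 (R + ‖z‖)).trans_lt hr
  linarith

theorem integrableOn_polar {φ : ℝ × ℝ → ℂ} (hφ : Continuous φ) {R : ℝ}
    (hR : ∀ p : ℝ × ℝ, R < p.1 → φ p = 0) :
    IntegrableOn φ (Ioi (0 : ℝ) ×ˢ Ioo (-Real.pi) Real.pi) := by
  have hK : IsCompact (Icc (0 : ℝ) R ×ˢ Icc (-Real.pi) Real.pi) := isCompact_Icc.prod isCompact_Icc
  refine (hφ.continuousOn.integrableOn_compact hK).of_forall_sdiff_eq_zero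
    (measurableSet_Ioi.prod measurableSet_Ioo) ?_
  rintro ⟨r, θ⟩ ⟨⟨h1, h2⟩, h3⟩
  refine hR _ (lt_of_not_ge fun h4 => h3 ⟨⟨?_, h4⟩, ⟨?_, ?_⟩⟩)
  · exact (mem_Ioi.1 h1).le
  · exact h2.1.le
  · exact h2.2.le

/-- The Cauchy–Pompeiu formula for compactly supported functions. -/
theorem integral_dbar_div_sub (hu : ContDiff ℝ 1 u) (hc : HasCompactSupport u) (z : ℂ) :
    ∫ w, dbar u w / (w - z) = -(2 * Real.pi) * u z := by
  obtain ⟨R, hR0, hR⟩ := exists_pos_eq_zero_of_lt_norm hc z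
  have hdiff : Differentiable ℝ u := hu.differentiable one_ne_zero
  have hfd : Continuous (fderiv ℝ u) := hu.continuous_fderiv one_ne_zero
  have hfd0 : ∀ r : ℝ, R < r → ∀ θ : ℝ, fderiv ℝ u (z + r * exp (θ * I)) = 0 := fun r hr θ =>
    image_eq_zero_of_notMem_tsupport fun h => hR r hr θ (tsupport_fderiv_subset ℝ h)
  set φ₁ : ℝ × ℝ → ℂ := fun p => fderiv ℝ u (z + p.1 * exp (p.2 * I)) (exp (p.2 * I)) with hφ₁
  set φ₂ : ℝ × ℝ → ℂ := fun p => fderiv ℝ u (z + p.1 * exp (p.2 * I)) (I * exp (p.2 * I)) with hφ₂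
  have hc₁ : Continuous φ₁ := by rw [hφ₁]; fun_prop
  have hc₂ : Continuous φ₂ := by rw [hφ₂]; fun_prop
  have hi₁ := integrableOn_polar hc₁ (R := R) fun p hp => by
    simp only [hφ₁, hfd0 p.1 hp, _root_.zero_apply]
  have hi₂ := integrableOn_polar hc₂ (R := R) fun p hp => by
    simp only [hφ₂, hfd0 p.1 hp, _root_.zero_apply]
  -- The radial derivative integrates along each ray from z to 0 - u(z), and the rays contribute a
  -- factor 2π.
  have h1 : ∫ p in Ioi (0 : ℝ) ×ˢ Ioo (-Real.pi) Real.pi, φ₁ p = -(2 * Real.pi) * u z := by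
    rw [Measure.volume_eq_prod, ← setIntegral_prod_swap, setIntegral_prod]
    · have inner : ∀ θ : ℝ, ∫ r in Ioi (0 : ℝ), φ₁ (r, θ) = - u z := by
        intro θ
        have hder : ∀ r ∈ Ici (0 : ℝ), HasDerivAt (fun r : ℝ => u (z + r * exp (θ * I)))
            (φ₁ (r, θ)) r := by
          intro r _
          have hin : HasDerivAt (fun r : ℝ => z + r * exp (θ * I)) (exp (θ * I)) r := by
            simpa using ((hasDerivAt_id r).ofReal_comp.mul_const (exp (θ * I))).const_add z
          exact (hdiff _).hasFDerivAt.comp_hasDerivAt r hin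
        have hint : IntegrableOn (fun r : ℝ => φ₁ (r, θ)) (Ioi 0) := by
          refine ((hc₁.comp (by fun_prop : Continuous fun r : ℝ => (r, θ))).continuousOn.integrableOn_compact
            (isCompact_Icc (a := (0 : ℝ)) (b := R))).of_forall_sdiff_eq_zero measurableSet_Ioi ?_
          rintro r ⟨hr1, hr2⟩
          have hr : R < r := lt_of_not_ge fun h => hr2 ⟨(mem_Ioi.1 hr1).le, h⟩
          simp only [hφ₁, Function.comp, hfd0 r hr, _root_.zero_apply]
        have hlim : Tendsto (fun r : ℝ => u (z + r * exp (θ * I))) atTop (𝓝 0) := by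
          refine tendsto_const_nhds.congr' ?_
          filter_upwards [eventually_gt_atTop R] with r hr
          exact (image_eq_zero_of_notMem_tsupport (hR r hr θ)).symm
        rw [integral_Ioi_of_hasDerivAt_of_tendsto' hder hint hlim]
        simp
      simp only [Prod.swap, inner]
      rw [setIntegral_const]
      simp [Measure.real, Real.volume_Ioo, Real.pi_pos.le]
      left
      ring
    · exact hi₁.swap
  -- On each circle r φ₂ is the angular derivative of u, whose integral vanishes by periodicity.
  have h2 : ∫ p in Ioi (0 : ℝ) ×ˢ Ioo (-Real.pi) Real.pi, φ₂ p = 0 := by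
    rw [Measure.volume_eq_prod, setIntegral_prod _ hi₂]
    refine setIntegral_eq_zero_of_forall_eq_zero fun r hr => ?_
    have hr0 : (r : ℂ) ≠ 0 := by exact_mod_cast (mem_Ioi.1 hr).ne'
    have hder : ∀ θ ∈ uIcc (-Real.pi) Real.pi,
        HasDerivAt (fun θ : ℝ => u (z + r * exp (θ * I))) (r * φ₂ (r, θ)) θ := by
      intro θ _
      have hin : HasDerivAt (fun θ : ℝ => z + r * exp (θ * I)) (r • (I * exp (θ * I))) θ := by
        have := ((((hasDerivAt_id θ).ofReal_comp.mul_const I).cexp.const_mul (r : ℂ)).const_add z)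
        refine this.congr_deriv ?_
        simp only [id, real_smul, ofReal_one]
        ring
      have := (hdiff (z + r * exp (θ * I))).hasFDerivAt.comp_hasDerivAt θ hin
      rwa [map_smul, real_smul] at this
    have hint : IntervalIntegrable (fun θ : ℝ => r * φ₂ (r, θ)) volume (-Real.pi) Real.pi :=
      (by fun_prop : Continuous fun θ : ℝ => (r : ℂ) * φ₂ (r, θ)).intervalIntegrable _ _
    have key := intervalIntegral.integral_eq_sub_of_hasDerivAt hder hint
    have e : exp ((-Real.pi : ℝ) * I) = exp ((Real.pi : ℝ) * I) := by
      rw [exp_pi_mul_I]; push_cast; rw [neg_mul, exp_neg, exp_pi_mul_I]; norm_num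
    rw [e, sub_self, intervalIntegral.integral_const_mul] at key
    have := (mul_eq_zero.1 key).resolve_left hr0
    rwa [intervalIntegral.integral_of_le (by linarith [Real.pi_pos]),
      integral_Ioc_eq_integral_Ioo] at this
  calc ∫ w, dbar u w / (w - z) = ∫ w, dbar u (z + w) / w := by
        have := integral_add_left_eq_self (μ := volume) (fun w => dbar u w / (w - z)) z
        simpa only [add_sub_cancel_left] using this.symm
    _ = ∫ p in Ioi (0 : ℝ) ×ˢ Ioo (-Real.pi) Real.pi, (φ₁ p + I * φ₂ p) := by
        -- The Jacobian r cancels the modulus of the denominator r exp(iθ).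
        rw [← Complex.integral_comp_polarCoord_symm, polarCoord_target]
        refine setIntegral_congr_fun (measurableSet_Ioi.prod measurableSet_Ioo) fun p hp => ?_
        have hp0 : (p.1 : ℂ) ≠ 0 := by exact_mod_cast (mem_Ioi.1 hp.1).ne'
        have e : Complex.polarCoord.symm p = p.1 * exp (p.2 * I) := by
          rw [Complex.polarCoord_symm_apply, exp_mul_I, ofReal_cos, ofReal_sin]
        simp only [hφ₁, hφ₂]
        rw [← dbar_mul_exp_neg, e, real_smul, exp_neg]
        have := exp_ne_zero (p.2 * I)
        field_simp
    _ = -(2 * Real.pi) * u z := by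
        rw [integral_add hi₁ (hi₂.const_mul I), integral_const_mul, h1, h2, mul_zero, add_zero]

end CauchyPompeiu

/-! ### Runge's theorem -/

section Runge

open MeasureTheory Set
open scoped Manifold

theorem exists_contDiff_cutoff {K U : Set ℂ} (hK : IsCompact K) (hU : IsOpen U) (hKU : K ⊆ U) :
    ∃ χ : ℂ → ℝ, ContDiff ℝ 1 χ ∧ HasCompactSupport χ ∧ tsupport χ ⊆ U ∧
      ∀ᶠ z in 𝓝ˢ K, χ z = 1 := by
  obtain ⟨L, hL, hKL, hLU⟩ := exists_compact_between hK hU hKU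
  obtain ⟨χ, h1, h0, -⟩ := exists_contMDiffMap_one_nhds_of_subset_interior (n := 1) 𝓘(ℝ, ℂ)
    hK.isClosed hKL
  have hsupp : tsupport χ ⊆ L := closure_minimal
    (fun z hz => by_contra fun hzL => hz (h0 z hzL)) hL.isClosed
  exact ⟨χ, χ.contMDiff.contDiff, hL.of_isClosed_subset (isClosed_tsupport _) hsupp,
    hsupp.trans hLU, h1⟩

/-- A function holomorphic near a compact set `K` extends, from a neighbourhood of `K`, to a
compactly supported function of class `C¹` on the plane. -/
theorem exists_contDiff_extension {K U : Set ℂ} (hK : IsCompact K) (hU : IsOpen U) (hKU : K ⊆ U)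
    {f : ℂ → ℂ} (hf : DifferentiableOn ℂ f U) :
    ∃ u : ℂ → ℂ, ContDiff ℝ 1 u ∧ HasCompactSupport u ∧ ∀ᶠ z in 𝓝ˢ K, u z = f z := by
  obtain ⟨χ, hχ, hc, hsupp, h1⟩ := exists_contDiff_cutoff hK hU hKU
  refine ⟨fun z => (χ z : ℂ) * f z, ?_, ?_, ?_⟩
  · rw [contDiff_iff_contDiffAt]
    intro z
    by_cases hz : z ∈ U
    · have h2 : ContDiffAt ℝ 1 f z :=
        ((hf.analyticAt (hU.mem_nhds hz)).contDiffAt (n := 1)).restrict_scalars ℝ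
      exact (Complex.ofRealCLM.contDiff.contDiffAt.comp z hχ.contDiffAt).mul h2
    · refine (contDiffAt_const (c := (0 : ℂ))).congr_of_eventuallyEq ?_
      filter_upwards [(isClosed_tsupport χ).isOpen_compl.mem_nhds fun h => hz (hsupp h)] with y hy
      rw [image_eq_zero_of_notMem_tsupport hy, Complex.ofReal_zero, zero_mul]
  · refine hc.mono fun z hz => ?_
    rw [Function.mem_support] at hz ⊢
    intro h0
    exact hz (by simp [h0])
  · filter_upwards [h1] with z hz
    rw [hz, Complex.ofReal_one, one_mul]

variable {K : Set ℂ}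

/-- The singularity w = z is met only at points of K, near which the numerator vanishes identically.
-/
theorem continuous_dbar_div_sub {u : ℂ → ℂ} (hu : ContDiff ℝ 1 u)
    (h0 : ∀ᶠ w in 𝓝ˢ K, dbar u w = 0) :
    Continuous fun x : ℂ × K => dbar u x.1 / (x.1 - x.2) := by
  rw [continuous_iff_continuousAt]
  rintro ⟨w, z⟩
  by_cases hwz : w = z
  · have h : ∀ᶠ w in 𝓝 w, dbar u w = 0 := by
      rw [hwz]
      exact h0.filter_mono (nhds_le_nhdsSet z.2)
    refine (continuousAt_const (y := (0 : ℂ))).congr ?_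
    filter_upwards [(continuous_fst.tendsto (w, z)).eventually h] with x hx
    rw [hx, zero_div]
  · refine ContinuousAt.div ?_ (by fun_prop) (sub_ne_zero.2 hwz)
    exact ((continuous_dbar hu).comp continuous_fst).continuousAt

variable [CompactSpace K]

/-- A closed subspace of `C(K)` containing all Cauchy kernels with poles off `K` contains all
functions that are holomorphic near `K`. -/
theorem mem_of_cauchyKernel_mem (S : Submodule ℂ C(K, ℂ)) (hS : IsClosed (S : Set C(K, ℂ)))
    (hker : ∀ w ∉ K, ∀ φ : C(K, ℂ), (∀ z : K, φ z = (w - z)⁻¹) → φ ∈ S)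
    {U : Set ℂ} (hU : IsOpen U) (hKU : K ⊆ U) {f : ℂ → ℂ} (hf : DifferentiableOn ℂ f U)
    {φ : C(K, ℂ)} (hφ : ∀ z : K, φ z = f z) : φ ∈ S := by
  have hK : IsCompact K := isCompact_iff_compactSpace.2 inferInstance
  obtain ⟨u, hu, hc, huf⟩ := exists_contDiff_extension hK hU hKU hf
  have h0 : ∀ᶠ w in 𝓝ˢ K, dbar u w = 0 := by
    rw [eventually_nhdsSet_iff_forall] at huf ⊢
    intro z hz
    filter_upwards [eventually_eventually_nhds.2 (huf z hz), hU.mem_nhds (hKU hz)] with w hw hwU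
    exact dbar_eq_zero_of_differentiableAt
      ((hf.differentiableAt (hU.mem_nhds hwU)).congr_of_eventuallyEq hw)
  have hcont := continuous_dbar_div_sub hu h0
  -- The Cauchy–Pompeiu integrand is regarded as a continuous C(K)-valued function of w. Its values
  -- lie in the closed subspace `S`, hence so does its Bochner integral.
  set F : ℂ → C(K, ℂ) := ⇑(ContinuousMap.curry ⟨_, hcont⟩) with hF
  have hFc : Continuous F := ContinuousMap.continuous _
  have hFapp : ∀ w (z : K), F w z = dbar u w / (w - z) := fun _ _ => rfl
  have hFS : ∀ w, F w ∈ S := by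
    intro w
    by_cases hw : w ∈ K
    · have : F w = 0 := by
        ext z
        rw [hFapp, h0.self_of_nhdsSet w hw, zero_div, ContinuousMap.zero_apply]
      rw [this]
      exact S.zero_mem
    · have hne : ∀ z : K, w - z ≠ 0 := fun z h => hw (by rw [sub_eq_zero.1 h]; exact z.2)
      have : F w = dbar u w • (⟨fun z : K => (w - z)⁻¹, by
          exact Continuous.inv₀ (by fun_prop) hne⟩ : C(K, ℂ)) := by
        ext z
        rw [hFapp, ContinuousMap.smul_apply, smul_eq_mul, div_eq_mul_inv]
        rfl
      rw [this]
      exact S.smul_mem _ (hker w hw _ fun _ => rfl)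
  have : CompleteSpace S := hS.completeSpace_coe
  set G : ℂ → S := fun w => ⟨F w, hFS w⟩ with hG
  have hGc : Continuous G := hFc.subtype_mk hFS
  have hGs : HasCompactSupport G := by
    refine (hc.fderiv ℝ).mono fun w hw => ?_
    rw [Function.mem_support] at hw ⊢
    intro h
    apply hw
    ext z
    change F w z = 0
    rw [hFapp, dbar, h]
    simp
  have hGi : Integrable G := hGc.integrable_of_hasCompactSupport hGs
  have key : φ = (-(2 * Real.pi) : ℂ)⁻¹ • ((∫ w, G w : S) : C(K, ℂ)) := by
    ext z
    have e1 : ((∫ w, G w : S) : C(K, ℂ)) z = ∫ w, F w z := by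
      have := ((ContinuousMap.evalCLM ℂ z).comp S.subtypeL).integral_comp_comm hGi
      exact this.symm
    have hpi : (-(2 * Real.pi) : ℂ) ≠ 0 := by simp [Real.pi_ne_zero]
    rw [ContinuousMap.smul_apply, e1]
    simp only [hFapp]
    rw [integral_dbar_div_sub hu hc, smul_eq_mul, inv_mul_cancel_left₀ hpi, hφ,
      huf.self_of_nhdsSet z z.2]
  rw [key]
  exact S.smul_mem _ (Subtype.property _)

/-- The algebra of restrictions to `K` of rational functions without poles in `Ω`. -/
def rationalSubalgebra (hKΩ : K ⊆ Ω) : Subalgebra ℂ C(K, ℂ) where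
  carrier := {φ | ∃ A B : ℂ[X], B ≠ 0 ∧ (∀ z : Ω, B.eval (z : ℂ) ≠ 0) ∧
    ∀ z : K, φ z = A.eval (z : ℂ) / B.eval (z : ℂ)}
  mul_mem' := by
    rintro φ ψ ⟨A, B, hB0, hB, h⟩ ⟨A', B', hB0', hB', h'⟩
    refine ⟨A * A', B * B', mul_ne_zero hB0 hB0', fun z => ?_, fun z => ?_⟩
    · rw [Polynomial.eval_mul]
      exact mul_ne_zero (hB z) (hB' z)
    · rw [ContinuousMap.mul_apply, h, h', Polynomial.eval_mul, Polynomial.eval_mul,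
        div_mul_div_comm]
  add_mem' := by
    rintro φ ψ ⟨A, B, hB0, hB, h⟩ ⟨A', B', hB0', hB', h'⟩
    refine ⟨A * B' + B * A', B * B', mul_ne_zero hB0 hB0', fun z => ?_, fun z => ?_⟩
    · rw [Polynomial.eval_mul]
      exact mul_ne_zero (hB z) (hB' z)
    · rw [ContinuousMap.add_apply, h, h', Polynomial.eval_add, Polynomial.eval_mul,
        Polynomial.eval_mul, Polynomial.eval_mul,
        div_add_div _ _ (hB ⟨z, hKΩ z.2⟩) (hB' ⟨z, hKΩ z.2⟩)]
  algebraMap_mem' c := ⟨Polynomial.C c, 1, one_ne_zero, by simp, by simp⟩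

/-- `K` has no holes in `Ω`: every point off `K` is joined, off `K`, to the complement of `Ω` or to
infinity. -/
def NoHolesIn (K Ω : Set ℂ) : Prop :=
  ∀ w ∉ K, ∃ C : Set ℂ, IsPreconnected C ∧ w ∈ C ∧ Disjoint C K ∧
    ((∃ a ∈ C, a ∉ Ω) ∨ ¬ Bornology.IsBounded C)

/-- The kernel is the resolvent at w of the coordinate function x, so it suffices that w is not in
the spectrum of x in the closed subalgebra `S`. The spectrum in C(K) is K; passing to `S` can only
fill in whole bounded components of the complement of K. The component of w is not filled: it is
unbounded or contains a point outside Ω, where the resolvent is a rational function in `S`. -/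
theorem cauchyKernel_mem_closure (hKΩ : K ⊆ Ω) (hK : NoHolesIn K Ω) {w : ℂ} (hw : w ∉ K)
    {φ : C(K, ℂ)} (hφ : ∀ z : K, φ z = (w - z)⁻¹) :
    φ ∈ (rationalSubalgebra hKΩ).topologicalClosure := by
  set S := (rationalSubalgebra hKΩ).topologicalClosure with hS
  have hScl : IsClosed (S : Set C(K, ℂ)) := Subalgebra.isClosed_topologicalClosure _
  have hle : rationalSubalgebra hKΩ ≤ S := Subalgebra.le_topologicalClosure _
  set x : S := ⟨⟨Subtype.val, continuous_subtype_val⟩,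
    hle ⟨Polynomial.X, 1, one_ne_zero, by simp, by simp⟩⟩ with hx
  have hrange : spectrum ℂ (x : C(K, ℂ)) = K := by
    rw [ContinuousMap.spectrum_eq_range]
    exact Subtype.range_val
  have hout : ∀ a ∉ Ω, a ∉ spectrum ℂ x := by
    intro a ha
    have hne : ∀ z : K, a - z ≠ 0 := fun z h => ha (by rw [sub_eq_zero.1 h]; exact hKΩ z.2)
    have hmem : (⟨fun z : K => (a - z)⁻¹, Continuous.inv₀ (by fun_prop) hne⟩ : C(K, ℂ)) ∈ S := by
      refine hle ⟨1, Polynomial.C a - Polynomial.X, ?_, fun z => ?_, fun z => ?_⟩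
      · rw [← neg_sub, neg_ne_zero]
        exact Polynomial.X_sub_C_ne_zero a
      · simp only [Polynomial.eval_sub, Polynomial.eval_C, Polynomial.eval_X]
        exact fun h => ha (by rw [sub_eq_zero.1 h]; exact z.2)
      · simp
    rw [spectrum.notMem_iff]
    refine IsUnit.of_mul_eq_one ⟨_, hmem⟩ ?_
    ext z
    exact mul_inv_cancel₀ (hne z)
  have hwx : w ∉ spectrum ℂ x := by
    intro hwx
    have hbdd := Subalgebra.spectrum_isBounded_connectedComponentIn S x hwx
    have hsub : connectedComponentIn Kᶜ w ⊆ spectrum ℂ x := by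
      rw [Subalgebra.spectrum_sUnion_connectedComponentIn S x, hrange]
      refine Subset.trans ?_ subset_union_right
      exact subset_biUnion_of_mem (u := fun z => connectedComponentIn Kᶜ z) ⟨hwx, hw⟩
    rw [hrange] at hbdd
    obtain ⟨C, hC, hwC, hCK, h⟩ := hK w hw
    have hCsub : C ⊆ connectedComponentIn Kᶜ w :=
      hC.subset_connectedComponentIn hwC hCK.subset_compl_right
    rcases h with ⟨a, haC, ha⟩ | h
    · exact hout a ha (hsub (hCsub haC))
    · exact h (hbdd.subset hCsub)
  rw [spectrum.notMem_iff] at hwx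
  obtain ⟨y, hy⟩ := hwx.exists_right_inv
  have : φ = y := by
    ext z
    have h1 : (w - z) * (y : C(K, ℂ)) z = 1 :=
      congrArg (fun s : S => (s : C(K, ℂ)) z) hy
    rw [hφ]
    exact (eq_inv_of_mul_eq_one_right h1).symm
  rw [this]
  exact y.2

/-- Runge's theorem. -/
theorem exists_rational_near (hKΩ : K ⊆ Ω) (hK : NoHolesIn K Ω) {f : ℂ → ℂ}
    (hf : DifferentiableOn ℂ f Ω) {ε : ℝ} (hε : 0 < ε) :
    ∃ A B : ℂ[X], B ≠ 0 ∧ (∀ z : Ω, B.eval (z : ℂ) ≠ 0) ∧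
      ∀ z ∈ K, ‖A.eval z / B.eval z - f z‖ < ε := by
  set φ : C(K, ℂ) := ⟨fun z => f z, continuousOn_iff_continuous_domRestrict.1
    (hf.mono hKΩ).continuousOn⟩ with hφ
  have hmem : φ ∈ (rationalSubalgebra hKΩ).topologicalClosure :=
    mem_of_cauchyKernel_mem (Subalgebra.toSubmodule (rationalSubalgebra hKΩ).topologicalClosure)
      (Subalgebra.isClosed_topologicalClosure _)
      (fun w hw ψ hψ => cauchyKernel_mem_closure hKΩ hK hw hψ) Ω.isOpen hKΩ hf fun _ => rfl
  obtain ⟨ψ, ⟨A, B, hB0, hB, hψ⟩, hdist⟩ := Metric.mem_closure_iff.1 hmem ε hε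
  refine ⟨A, B, hB0, hB, fun z hz => ?_⟩
  have := (ContinuousMap.dist_apply_le_dist (f := φ) (g := ψ) ⟨z, hz⟩).trans_lt hdist
  rwa [dist_comm, dist_eq_norm, hψ] at this

end Runge

/-! ### Exhaustion by compact sets without holes -/

section Exhaustion

variable (Ω) in
/-- The points of norm at most `R` and of distance at least `δ` to the complement of `Ω`. -/
def insetBall (R δ : ℝ) : Set ℂ := {z | ‖z‖ ≤ R ∧ ∀ a ∉ Ω, δ ≤ dist z a}

theorem insetBall_subset {R δ : ℝ} (hδ : 0 < δ) : insetBall Ω R δ ⊆ Ω := by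
  intro z hz
  by_contra h
  have := hz.2 z h
  rw [dist_self] at this
  linarith

theorem isCompact_insetBall (R δ : ℝ) : IsCompact (insetBall Ω R δ) := by
  refine (isCompact_closedBall (0 : ℂ) R).of_isClosed_subset ?_
    fun z hz => mem_closedBall_zero_iff.2 hz.1
  have : insetBall Ω R δ = {z | ‖z‖ ≤ R} ∩ ⋂ a, ⋂ (_ : a ∉ Ω), {z | δ ≤ dist z a} := by
    ext z
    simp [insetBall]
  rw [this]
  refine (isClosed_le continuous_norm continuous_const).inter ?_
  exact isClosed_iInter fun a => isClosed_iInter fun _ =>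
    isClosed_le continuous_const (continuous_id.dist continuous_const)

theorem not_isBounded_ray {w : ℂ} (hw : w ≠ 0) :
    ¬ Bornology.IsBounded ((fun t : ℝ => t • w) '' Set.Ici 1) := by
  intro h
  obtain ⟨M, hM⟩ := h.exists_norm_le
  have hw' : 0 < ‖w‖ := norm_pos_iff.2 hw
  have h1 := hM _ ⟨max 1 ((M + 1) / ‖w‖), Set.mem_Ici.2 (le_max_left _ _), rfl⟩
  rw [norm_smul, Real.norm_of_nonneg (zero_le_one.trans (le_max_left _ _))] at h1
  have h2 := mul_le_mul_of_nonneg_right (le_max_right 1 ((M + 1) / ‖w‖)) hw'.le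
  rw [div_mul_cancel₀ _ hw'.ne'] at h2
  linarith

/-- A point off the set is either within δ of some a ∉ Ω, and the ball of radius δ about a misses
the set, or has norm above R, and its outward radial ray escapes to infinity. -/
theorem noHolesIn_insetBall {R δ : ℝ} (hR : 0 ≤ R) : NoHolesIn (insetBall Ω R δ) Ω := by
  intro w hw
  by_cases hwR : ‖w‖ ≤ R
  · obtain ⟨a, ha, hwa⟩ : ∃ a ∉ Ω, dist w a < δ := by
      by_contra! h
      exact hw ⟨hwR, h⟩
    refine ⟨Metric.ball a δ, (convex_ball a δ).isPreconnected, hwa, ?_,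
      Or.inl ⟨a, Metric.mem_ball_self (dist_nonneg.trans_lt hwa), ha⟩⟩
    rw [Set.disjoint_left]
    exact fun z hz hz' => (hz'.2 a ha).not_gt hz
  · rw [not_le] at hwR
    have hw0 : w ≠ 0 := norm_pos_iff.1 (hR.trans_lt hwR)
    refine ⟨(fun t : ℝ => t • w) '' Set.Ici 1,
      isPreconnected_Ici.image _ (by fun_prop), ⟨1, Set.mem_Ici.2 le_rfl, one_smul _ _⟩, ?_,
      Or.inr (not_isBounded_ray hw0)⟩
    rw [Set.disjoint_left]
    rintro _ ⟨t, ht, rfl⟩ hz'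
    have h1 : ‖t • w‖ ≤ R := hz'.1
    have ht' : (1 : ℝ) ≤ t := ht
    rw [norm_smul, Real.norm_of_nonneg (zero_le_one.trans ht')] at h1
    have := mul_le_mul_of_nonneg_right ht' (norm_nonneg w)
    linarith

theorem eventually_subset_insetBall {K : Set ℂ} (hK : IsCompact K) (hKΩ : K ⊆ Ω) :
    ∀ᶠ n : ℕ in atTop, K ⊆ insetBall Ω n (1 / ((n : ℝ) + 1)) := by
  obtain ⟨R, hR⟩ := hK.isBounded.exists_norm_le
  obtain ⟨δ, hδ, hKδ⟩ := hK.exists_thickening_subset_open Ω.isOpen hKΩ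
  have h1 : ∀ᶠ n : ℕ in atTop, 1 / ((n : ℝ) + 1) < δ :=
    tendsto_one_div_add_atTop_nhds_zero_nat.eventually_lt_const hδ
  filter_upwards [h1, tendsto_natCast_atTop_atTop.eventually_ge_atTop R] with n hn hRn z hz
  refine ⟨(hR z hz).trans hRn, fun a ha => ?_⟩
  by_contra! h
  exact ha (hKδ (Metric.mem_thickening_iff.2 ⟨z, hz, by rw [dist_comm]; exact h.trans hn⟩))

variable (Ω) in
/-- A compact exhaustion of `Ω` by sets without holes in `Ω`. -/
def insetExhaustion (n : ℕ) : Set Ω := Subtype.val ⁻¹' insetBall Ω n (1 / ((n : ℝ) + 1))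

theorem isCompact_insetExhaustion (n : ℕ) : IsCompact (insetExhaustion Ω n) := by
  rw [Subtype.isCompact_iff, insetExhaustion, Set.image_preimage_eq_of_subset]
  · exact isCompact_insetBall _ _
  · exact (insetBall_subset (by positivity)).trans Subtype.range_val.superset

theorem eventually_subset_insetExhaustion {K : Set Ω} (hK : IsCompact K) :
    ∀ᶠ n : ℕ in atTop, K ⊆ insetExhaustion Ω n := by
  filter_upwards [eventually_subset_insetBall (Subtype.isCompact_iff.1 hK)
    (by rintro _ ⟨z, _, rfl⟩; exact z.2)] with n hn z hz
  exact hn ⟨z, hz, rfl⟩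

end Exhaustion

/-! ### The Baire category argument -/

instance : BaireSpace (HolomorphicFunctions Ω) := by
  have : LocallyCompactSpace Ω := Ω.isOpen.locallyCompactSpace
  have : CompleteSpace (HolomorphicFunctions Ω) :=
    isClosed_setOf_differentiableOn_extendZero.completeSpace_coe
  have : (uniformity (HolomorphicFunctions Ω)).IsCountablyGenerated := by
    rw [uniformity_subtype]
    infer_instance
  infer_instance

/-- The functions equal, for a fixed type in `ℱ`, to all their Padé approximants of that type. -/
theorem dense_setOf_pade_eq {ℱ : Set (ℕ × ℕ)}
    (hℱ : ∃ p q : ℕ → ℕ, (∀ n, (p n, q n) ∈ ℱ) ∧ Tendsto p atTop atTop ∧ Tendsto q atTop atTop) :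
    Dense {f : HolomorphicFunctions Ω | ∃ p q : ℕ, (p, q) ∈ ℱ ∧
      ∀ ζ z : Ω, MemPadeClass f p q ζ ∧ padeError f p q ζ z = 0} := by
  intro f
  have hex : ∀ n : ℕ, ∃ g : HolomorphicFunctions Ω, (∃ p q : ℕ, (p, q) ∈ ℱ ∧
      ∀ ζ z : Ω, MemPadeClass g p q ζ ∧ padeError g p q ζ z = 0) ∧
      -- One 1/(n+1) is spent on Runge approximation, the other on the perturbation δ zᵏ, which is
      -- controlled on the disc of radius n.
      ∀ z ∈ insetExhaustion Ω n, ‖g.1 z - f.1 z‖ < 2 * (1 / ((n : ℝ) + 1)) := by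
    intro n
    have hpos : (0 : ℝ) < 1 / ((n : ℝ) + 1) := by positivity
    have hcomp := isCompact_iff_compactSpace.1
      (isCompact_insetBall (Ω := Ω) n (1 / ((n : ℝ) + 1)))
    obtain ⟨A, B, hB0, hB, hAB⟩ := exists_rational_near (Ω := Ω) (insetBall_subset hpos)
      (noHolesIn_insetBall (Nat.cast_nonneg n)) f.2 hpos
    obtain ⟨g, hg, hpade⟩ := exists_pade_eq_near_rational hℱ (A := A) (R := n) hB0 hB hpos
    refine ⟨g, hpade, fun z hz => ?_⟩
    have h1 := hg z hz.1
    have h2 := hAB z hz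
    rw [extendZero_apply] at h2
    calc ‖g.1 z - f.1 z‖ = ‖(g.1 z - A.eval (z : ℂ) / B.eval (z : ℂ)) +
          (A.eval (z : ℂ) / B.eval (z : ℂ) - f.1 z)‖ := by congr 1; ring
      _ ≤ _ := norm_add_le _ _
      _ < _ := by linarith
  choose g hg hgf using hex
  refine mem_closure_of_tendsto (f := g) (b := atTop) ?_ (Eventually.of_forall hg)
  rw [tendsto_subtype_rng, ContinuousMap.tendsto_iff_forall_isCompact_tendstoUniformlyOn]
  intro K hK
  rw [Metric.tendstoUniformlyOn_iff]
  intro ε hε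
  have hlim : Tendsto (fun n : ℕ => 2 * (1 / ((n : ℝ) + 1))) atTop (𝓝 0) := by
    simpa using tendsto_one_div_add_atTop_nhds_zero_nat.const_mul (2 : ℝ)
  filter_upwards [eventually_subset_insetExhaustion hK, hlim.eventually_lt_const hε]
    with n hn hnε z hz
  rw [dist_comm, dist_eq_norm]
  exact (hgf n z (hn hz)).trans hnε

/-- Every compact subset of Ω lies in all late members of the exhaustion, so choosing for each n a
type that works on the n-th member gives one sequence serving all compact sets. -/
theorem setOf_isApproximatedByPade_eq (ℱ : Set (ℕ × ℕ)) :
    {f : HolomorphicFunctions Ω | IsApproximatedByPade ℱ f} =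
      ⋂ n : ℕ, ⋃ r ∈ ℱ, {f | ∀ x ∈ insetExhaustion Ω n ×ˢ insetExhaustion Ω n,
        MemPadeClass f r.1 r.2 x.1 ∧ padeError f r.1 r.2 x.1 x.2 < (n : ℝ≥0∞)⁻¹} := by
  ext f
  simp only [Set.mem_ofPred_eq, Set.mem_iInter, Set.mem_iUnion, exists_prop]
  constructor
  · rintro ⟨p, q, hpq, h⟩ n
    obtain ⟨⟨n₀, hn₀⟩, hlim⟩ := h _ (isCompact_insetExhaustion n)
    -- This includes n = 0, where the inverse is ∞.
    have hpos : (0 : ℝ≥0∞) < (n : ℝ≥0∞)⁻¹ := ENNReal.inv_pos.2 (ENNReal.natCast_ne_top n)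
    obtain ⟨k, hk, hk₀⟩ :=
      ((hlim.eventually_lt_const hpos).and (eventually_ge_atTop n₀)).exists
    refine ⟨(p k, q k), hpq k, fun x hx => ⟨hn₀ k hk₀ _ hx.1, lt_of_le_of_lt ?_ hk⟩⟩
    exact (le_iSup₂ (f := fun z (_ : z ∈ insetExhaustion Ω n) => padeError f (p k) (q k) x.1 z)
      x.2 hx.2).trans (le_iSup₂ (f := fun ζ (_ : ζ ∈ insetExhaustion Ω n) =>
        ⨆ z ∈ insetExhaustion Ω n, padeError f (p k) (q k) ζ z) x.1 hx.1)
  · intro h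
    choose r hr h using h
    refine ⟨fun n => (r n).1, fun n => (r n).2, hr, fun K hK => ⟨?_, ?_⟩⟩
    · obtain ⟨n₀, hn₀⟩ := eventually_atTop.1 (eventually_subset_insetExhaustion hK)
      -- The condition is stated for pairs, so a centre alone is tested on the diagonal.
      exact ⟨n₀, fun n hn ζ hζ => (h n (ζ, ζ) ⟨hn₀ n hn hζ, hn₀ n hn hζ⟩).1⟩
    · refine tendsto_of_tendsto_of_tendsto_of_le_of_le' tendsto_const_nhds
        ENNReal.tendsto_inv_nat_nhds_zero (Eventually.of_forall fun _ => zero_le) ?_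
      filter_upwards [eventually_subset_insetExhaustion hK] with n hn
      exact iSup₂_le fun ζ hζ => iSup₂_le fun z hz => (h n (ζ, z) ⟨hn hζ, hn hz⟩).2.le

end HolomorphicApproximation

theorem theorem5p6 (Ω : TopologicalSpace.Opens ℂ) (ℱ : Set (ℕ × ℕ))
    (hℱ : ∃ p q : ℕ → ℕ, (∀ n, (p n, q n) ∈ ℱ) ∧ Tendsto p atTop atTop ∧ Tendsto q atTop atTop) :
    (∃ f : HolomorphicFunctions Ω, IsApproximatedByPade ℱ f) ∧
      IsGδ {f : HolomorphicFunctions Ω | IsApproximatedByPade ℱ f} ∧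
      Dense {f : HolomorphicFunctions Ω | IsApproximatedByPade ℱ f} := by
  have hopen : ∀ n : ℕ, IsOpen (⋃ r ∈ ℱ, {f : HolomorphicFunctions Ω |
      ∀ x ∈ insetExhaustion Ω n ×ˢ insetExhaustion Ω n,
        MemPadeClass f r.1 r.2 x.1 ∧ padeError f r.1 r.2 x.1 x.2 < (n : ℝ≥0∞)⁻¹}) := fun n =>
    isOpen_biUnion fun r _ => isOpen_setOf_forall_padeError_lt (isCompact_insetExhaustion n) _ _ _
  have hdense : Dense {f : HolomorphicFunctions Ω | IsApproximatedByPade ℱ f} := by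
    rw [setOf_isApproximatedByPade_eq]
    -- Baire's theorem; the functions with zero error lie in every one of the open sets.
    refine dense_iInter_of_isOpen hopen fun n => (dense_setOf_pade_eq hℱ).mono ?_
    rintro f ⟨p, q, hpq, hf⟩
    refine Set.mem_biUnion hpq fun x _ => ⟨(hf x.1 x.2).1, ?_⟩
    rw [(hf x.1 x.2).2]
    exact ENNReal.inv_pos.2 (ENNReal.natCast_ne_top n)
  refine ⟨?_, ?_, hdense⟩
  · have : Nonempty (HolomorphicFunctions Ω) :=
      ⟨holomorphicOfDifferentiableOn 0 (differentiableOn_const 0)⟩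
    exact hdense.nonempty
  · rw [setOf_isApproximatedByPade_eq]
    exact IsGδ.iInter fun n => (hopen n).isGδ
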